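/- Let $M$ be a (non-empty) smooth manifold of dimension $2n$ with $n\ge 2$, and equip $TM\oplus T^*M$ with the neutral metric $\langle X+\alpha,Y+\beta\rangle=\frac12(\alpha(Y)+\beta(X))$. Let $E$ be a generalized metric of signature $(n,n)$ on $M$: a smooth subbundle $E\subset TM\oplus T^*M$ of rank $2n$ such that $\langle\cdot,\cdot\rangle|_E$ has signature $(n,n)$ and $E_x\cap T_x^*M=\{0\}$ for all $x\in M$. Put $E'=E$, $E''=E^\perp$, let $D'$, $D''$ be smooth metric connections on $E'$ and $E''$, and let $D=D'\oplus D''$ be the resulting connection on $TM\oplus T^*M=E'\oplus E''$, and also the one it induces on $\mathrm{End}(TM\oplus T^*M)$. The generalized reflector space $\pi:\mathcal G=\mathcal G(E)\to M$ is the subbundle of $\mathrm{End}(TM\oplus T^*M)$ whose fibre at $p$ consists of the endomorphisms $K$ of $T_pM\oplus T_p^*M$ that satisfy $K^2=\mathrm{Id}$, $K\ne\pm\mathrm{Id}$, are skew-symmetric for $\langle\cdot,\cdot\rangle$, and satisfy $KE_p\subset E_p$. The $D$-horizontal spaces are tangent to $\mathcal G$, so $T\mathcal G=\mathcal H\oplus\mathcal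 V$ with $\mathcal V$ the vertical bundle; the vertical space $\mathcal V_K$ consists of the $\langle\cdot,\cdot\rangle$-skew endomorphisms $V$ which anti-commute with $K$ and preserve $E_p$. For $V\in\mathcal V_K$ write $V=(V',V'')$, $K=(K',K'')$ for the restrictions to $E'_p$, $E''_p$, and set $$\mathcal P_1V=(K'V',K''V''),\quad \mathcal P_2V=(K'V',-K''V''),\quad \mathcal P_3=-\mathcal P_2,\quad \mathcal P_4=-\mathcal P_1 .$$ For $\varepsilon=1,\dots,4$ let $\mathcal K_\varepsilon$ be the generalized almost paracomplex structure on the manifold $\mathcal G$ (an endomorphism of $T\mathcal G\oplus T^*\mathcal G$) given at $K$ by $$\mathcal K_\varepsilon A^h=(KA)^h\ \ (A\in T_pM\oplus T_p^*M),\qquad \mathcal K_\varepsilon=\mathcal P_\varepsilon\ \text{on}\ \mathcal V_K,\qquad \mathcal K_\varepsilon=-\mathcal P_\varepsilon^*\ \text{on}\ \mathcal V_K^*,$$ where, for $A=X+\omega$, $A^h=X^h+\pi^*\omega$ with $X^h$ the horizontal lift of $X$, and forms in $\mathcal V_K^*$ are extended by $0$ on $\mathcal H_K$. Such a structure $\mathcal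 K$ is called integrable if its Nijenhuis tensor $N(A,B)=[A,B]+[\mathcal KA,\mathcal KB]-\mathcal K[\mathcal KA,B]-\mathcal K[A,\mathcal KB]$ vanishes, $[\cdot,\cdot]$ being the Courant bracket $[X+\alpha,Y+\beta]=[X,Y]+\mathcal L_X\beta-\mathcal L_Y\alpha-\frac12 d(\imath_X\beta-\imath_Y\alpha)$. Then, for every such $M$, $E$, $D'$, $D''$, none of the structures $\mathcal K_2$, $\mathcal K_3$, $\mathcal K_4$ is integrable. -/

import Mathlib

open scoped Manifold ContDiff Bundle Topology
open Bundle

noncomputable section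

namespace GenReflector

/-! ### Linear algebra of `T ⊕ T*` -/

section Linear

variable (T : Type*) [AddCommGroup T] [Module ℝ T] [TopologicalSpace T]

/-- The space `T ⊕ T*`. -/
abbrev GenVec : Type _ := T × (T →L[ℝ] ℝ)

variable {T}

section Pairing

/-- The neutral metric `⟨X + α, Y + β⟩ = ½ (α(Y) + β(X))` on `T ⊕ T*`. -/
def pairing : LinearMap.BilinForm ℝ (GenVec T) :=
  LinearMap.mk₂ ℝ (fun A B => (1 / 2 : ℝ) * (A.2 B.1 + B.2 A.1))
    (fun A A' B => by simp; ring) (fun c A B => by simp; ring)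
    (fun A B B' => by simp; ring) (fun c A B => by simp; ring)

theorem pairing_isRefl : (pairing (T := T)).IsRefl := by
  intro A B h
  change (1 / 2 : ℝ) * (A.2 B.1 + B.2 A.1) = 0 at h
  change (1 / 2 : ℝ) * (B.2 A.1 + A.2 B.1) = 0
  linarith

/-- A generalized paracomplex structure on `T`: a product structure on `T ⊕ T*`
(`K² = Id`, `K ≠ ± Id`) which is skew-symmetric for the neutral metric. -/
structure IsGenParacomplex (K : GenVec T →ₗ[ℝ] GenVec T) : Prop where
  sq : ∀ A, K (K A) = A
  ne_id : K ≠ LinearMap.id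
  ne_neg_id : K ≠ -LinearMap.id
  skew : ∀ A B, pairing (K A) B + pairing A (K B) = 0

/-- A generalized metric of neutral signature `(n, n)` on `T`: a subspace `E` of `T ⊕ T*` with
`dim E = dim T`, `E ∩ T* = 0`, on which the neutral metric of `T ⊕ T*` has signature `(n, n)`. -/
structure IsGenMetric (n : ℕ) (E : Submodule ℝ (GenVec T)) : Prop where
  finrank_eq : Module.finrank ℝ E = Module.finrank ℝ T
  signature : ∃ b : Module.Basis (Fin n ⊕ Fin n) ℝ E,
    ∀ i j, pairing (b i : GenVec T) (b j : GenVec T) =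
      if i = j then Sum.elim (fun _ => (1 : ℝ)) (fun _ => -1) i else 0
  inter_dual : ∀ A ∈ E, A.1 = 0 → A = 0

/-- `E'' = E^⊥`, the orthogonal complement for the neutral metric. -/
abbrev perp (E : Submodule ℝ (GenVec T)) : Submodule ℝ (GenVec T) := pairing.orthogonal E

theorem IsGenMetric.isCompl [FiniteDimensional ℝ (GenVec T)] {n : ℕ}
    {E : Submodule ℝ (GenVec T)} (h : IsGenMetric n E) : IsCompl E (perp E) := by
  rw [LinearMap.BilinForm.isCompl_orthogonal_iff_disjoint pairing_isRefl, Submodule.disjoint_def]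
  intro A hA hA'
  obtain ⟨b, hb⟩ := h.signature
  have key : ∀ i, b.repr ⟨A, hA⟩ i = 0 := by
    intro i
    have h1 : pairing (b i : GenVec T) A = 0 := hA' _ (b i).2
    have h2 : A = ∑ j, b.repr ⟨A, hA⟩ j • (b j : GenVec T) := by
      calc A = ((⟨A, hA⟩ : E) : GenVec T) := rfl
        _ = ((∑ j, b.repr ⟨A, hA⟩ j • b j : E) : GenVec T) := by rw [b.sum_repr]
        _ = _ := by rw [Submodule.coe_sum]; rfl
    rw [h2, map_sum] at h1
    simp only [map_smul, hb, smul_eq_mul, mul_ite, mul_zero, Finset.sum_ite_eq,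
      Finset.mem_univ, if_true] at h1
    rcases i with i | i <;> simpa using h1
  have h3 : (⟨A, hA⟩ : E) = 0 := by
    apply b.repr.injective
    ext i
    simpa using key i
  exact congrArg Subtype.val h3

/-- The set of generalized paracomplex structures on `T` compatible with `E`, i.e. preserving `E`:
the fibre of the generalized reflector space. -/
def compatible (E : Submodule ℝ (GenVec T)) : Set (GenVec T →ₗ[ℝ] GenVec T) :=
  {K | IsGenParacomplex K ∧ ∀ A ∈ E, K A ∈ E}

end Pairing

end Linear

/-! ### Generalized geometry of an embedded submanifold `S` of a vector space `W`

Smooth objects on `S` are, locally, restrictions of smooth objects on open subsets of `W`; a section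
of `TS ⊕ T*S` is given by a map into `W ⊕ W*` whose vector part is tangent to `S` along `S`, and two
such maps give the same section if they have the same vector part along `S` and their `1`-forms
agree on the tangent spaces of `S`. -/

section Submanifold

variable {W : Type*} [NormedAddCommGroup W] [NormedSpace ℝ W]

/-- The tangent space of `S` at `a`: the velocities at `a` of curves lying in `S`. -/
def tangentSet (S : Set W) (a : W) : Set W :=
  {v | ∃ γ : ℝ → W, γ 0 = a ∧ (∀ᶠ t in 𝓝 (0 : ℝ), γ t ∈ S) ∧ HasDerivAt γ v 0}

/-- `𝔸` and `𝔹` have the same restriction to `S` at `a`, i.e. they have the same vector part, and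
their `1`-forms agree on the tangent space of `S`. -/
def GenEq (S : Set W) (a : W) (𝔸 𝔹 : GenVec W) : Prop :=
  𝔸.1 = 𝔹.1 ∧ ∀ v ∈ tangentSet S a, 𝔸.2 v = 𝔹.2 v

/-- The Lie derivative `(L_X β)(Z) = X(β(Z)) - β([X, Z])` of a `1`-form in a vector space
(the formula for constant `Z`). -/
def lieDerivForm (X : W → W) (β : W → W →L[ℝ] ℝ) (a : W) : W →L[ℝ] ℝ :=
  fderiv ℝ β a (X a) + (β a).comp (fderiv ℝ X a)

/-- The Courant bracket
`[X + α, Y + β] = [X, Y] + L_X β - L_Y α - ½ d(ι_X β - ι_Y α)`. -/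
def courant (A B : W → GenVec W) (a : W) : GenVec W :=
  (VectorField.lieBracket ℝ (fun b => (A b).1) (fun b => (B b).1) a,
    lieDerivForm (fun b => (A b).1) (fun b => (B b).2) a
      - lieDerivForm (fun b => (B b).1) (fun b => (A b).2) a
      - (1 / 2 : ℝ) • fderiv ℝ (fun b => (B b).2 (A b).1 - (A b).2 (B b).1) a)

/-- `A : W → W ⊕ W*` represents a smooth section of `TS ⊕ T*S` over `S ∩ O`, for `O` open. -/
def IsGenSection (S O : Set W) (A : W → GenVec W) : Prop :=
  ContDiffOn ℝ ∞ A O ∧ ∀ a ∈ S ∩ O, (A a).1 ∈ tangentSet S a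

/-- `𝒦` is the field of endomorphisms of `TS ⊕ T*S` (given at each point `a` of `S` by a map of
`W ⊕ W*` inducing it). It is integrable if its Nijenhuis tensor
`N(A, B) = [A, B] + [𝒦A, 𝒦B] - 𝒦[𝒦A, B] - 𝒦[A, 𝒦B]`, formed with the Courant bracket,
vanishes for all local sections `A`, `B` of `TS ⊕ T*S`. Here `KA` and `KB` represent the sections
`𝒦A` and `𝒦B` (their vector parts are tangent to `S` along `S` since `𝒦` preserves
`TS ⊕ T*S`). -/
def IsIntegrable (S : Set W) (𝒦 : W → GenVec W → GenVec W) : Prop :=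
  ∀ O : Set W, IsOpen O → ∀ A B KA KB : W → GenVec W,
    IsGenSection S O A → IsGenSection S O B → ContDiffOn ℝ ∞ KA O → ContDiffOn ℝ ∞ KB O →
    (∀ a ∈ S ∩ O, GenEq S a (KA a) (𝒦 a (A a))) →
    (∀ a ∈ S ∩ O, GenEq S a (KB a) (𝒦 a (B a))) →
    ∀ a ∈ S ∩ O,
      GenEq S a
        (courant A B a + courant KA KB a - 𝒦 a (courant KA B a) - 𝒦 a (courant A KB a)) 0

end Submanifold

/-! ### The four structures, in coordinates

Here `X` is the coordinate space of the base, and `(y, K)` are the coordinates of a point of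
`End(TM ⊕ T*M)`. The connection form `Γ` of a connection on `TM ⊕ T*M` at `y` and the projection
`p` of `TM ⊕ T*M = E' ⊕ E''` onto `E'` at `y` are parameters. -/

/-- The index `ε = 1, 2, 3, 4`. -/
inductive Index
  | one | two | three | four

/-- The sign of `𝒫_ε(V', V'')` in the component `± K'V'`. -/
def Index.sgn₁ : Index → ℝ
  | .one => 1 | .two => 1 | .three => -1 | .four => -1

/-- The sign of `𝒫_ε(V', V'')` in the component `± K''V''`. -/
def Index.sgn₂ : Index → ℝ
  | .one => 1 | .two => -1 | .three => 1 | .four => -1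

section Structures

variable {X F : Type*} [NormedAddCommGroup X] [NormedSpace ℝ X]
  [NormedAddCommGroup F] [NormedSpace ℝ F]

/-- The horizontal lift `v ↦ v^h` at a point `(y, K)`, for the connection induced on the bundle of
endomorphisms by a connection with connection form `Γ` (at `y`): in coordinates
`v^h = (v, -[Γ(v), K])`. Here `F` is the fibre. -/
def horLift (Γ : X →L[ℝ] F →L[ℝ] F) (K : F →L[ℝ] F) : X →L[ℝ] X × (F →L[ℝ] F) :=
  (ContinuousLinearMap.id ℝ X).prod
    (((ContinuousLinearMap.compL ℝ F F F) K).comp Γ -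
      ((ContinuousLinearMap.compL ℝ F F F).flip K).comp Γ)

theorem horLift_apply (Γ : X →L[ℝ] F →L[ℝ] F) (K : F →L[ℝ] F) (v : X) :
    horLift Γ K v = (v, -((Γ v).comp K - K.comp (Γ v))) := by
  simp [horLift]

/-- The vertical projection `ξ ↦ ξ - (π_* ξ)^h` at a point `(y, K)`. -/
def verProj (Γ : X →L[ℝ] F →L[ℝ] F) (K : F →L[ℝ] F) : X × (F →L[ℝ] F) →L[ℝ] F →L[ℝ] F :=
  (ContinuousLinearMap.snd ℝ X (F →L[ℝ] F)).comp
    (ContinuousLinearMap.id ℝ (X × (F →L[ℝ] F)) -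
      (horLift Γ K).comp (ContinuousLinearMap.fst ℝ X (F →L[ℝ] F)))

theorem verProj_apply (Γ : X →L[ℝ] F →L[ℝ] F) (K : F →L[ℝ] F) (ξ : X × (F →L[ℝ] F)) :
    verProj Γ K ξ = ξ.2 + ((Γ ξ.1).comp K - K.comp (Γ ξ.1)) := by
  simp only [verProj, horLift_apply, ContinuousLinearMap.comp_apply, sub_apply,
    ContinuousLinearMap.id_apply, ContinuousLinearMap.coe_fst', ContinuousLinearMap.coe_snd',
    Prod.snd_sub, sub_neg_eq_add]

/-- The paracomplex structures of the fibres of `𝒢(E)`: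
`𝒫₁(V', V'') = (K'V', K''V'')`, `𝒫₂(V', V'') = (K'V', -K''V'')`, `𝒫₃ = -𝒫₂`, `𝒫₄ = -𝒫₁`, where
`V' = V|E'` and `V'' = V|E''`. -/
def fibreStructure (p : F →L[ℝ] F) (ε : Index) (K : F →L[ℝ] F) :
    (F →L[ℝ] F) →L[ℝ] (F →L[ℝ] F) :=
  (ContinuousLinearMap.compL ℝ F F F K).comp
    ((ContinuousLinearMap.compL ℝ F F F).flip
      (ε.sgn₁ • p + ε.sgn₂ • (ContinuousLinearMap.id ℝ F - p)))

theorem fibreStructure_apply (p : F →L[ℝ] F) (ε : Index) (K V : F →L[ℝ] F) (A : F) :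
    fibreStructure p ε K V A = ε.sgn₁ • K (V (p A)) + ε.sgn₂ • K (V (A - p A)) := by
  simp [fibreStructure]

/-- The bilinear map `Γ` with `Γ(v) (b i) = c i v` for the elements `b i` of a basis. -/
def bilinOfBasis [FiniteDimensional ℝ F] {ι : Type*} [Fintype ι]
    (b : Module.Basis ι ℝ F) (c : ι → X →L[ℝ] F) : X →L[ℝ] F →L[ℝ] F :=
  ∑ i, (ContinuousLinearMap.smulRightL ℝ F F
    (LinearMap.toContinuousLinearMap (b.coord i))).comp (c i)

theorem bilinOfBasis_apply [FiniteDimensional ℝ F] {ι : Type*} [Fintype ι]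
    (b : Module.Basis ι ℝ F) (c : ι → X →L[ℝ] F) (v : X) (i : ι) :
    bilinOfBasis b c v (b i) = c i v := by
  classical
  simp [bilinOfBasis, Finsupp.single_apply, ite_smul]

variable (X) in
/-- The endomorphisms of `X ⊕ X*`. -/
abbrev EndGen : Type _ := GenVec X →L[ℝ] GenVec X

variable (X) in
/-- The vector space `X × End(X ⊕ X*)`. -/
abbrev Ambient : Type _ := X × EndGen X

/-! Shortcuts for the instance search. -/

instance : NormedAddCommGroup (GenVec X) := inferInstance
instance : SeminormedAddCommGroup (GenVec X) := inferInstance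
instance : NormedSpace ℝ (GenVec X) := inferInstance
instance : AddCommGroup (GenVec X) := inferInstance
instance : AddCommMonoid (GenVec X) := inferInstance
instance : Module ℝ (GenVec X) := inferInstance
instance : TopologicalSpace (GenVec X) := inferInstance
instance : IsTopologicalAddGroup (GenVec X) := inferInstance
instance : NormedAddCommGroup (EndGen X) := inferInstance
instance : SeminormedAddCommGroup (EndGen X) := inferInstance
instance : NormedSpace ℝ (EndGen X) := inferInstance
instance : AddCommGroup (EndGen X) := inferInstance
instance : AddCommMonoid (EndGen X) := inferInstance
instance : Module ℝ (EndGen X) := inferInstance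
instance : TopologicalSpace (EndGen X) := inferInstance
instance : IsTopologicalAddGroup (EndGen X) := inferInstance

/-- The generalized almost paracomplex structure `𝒦_ε` of `𝒢(E)` at a point `(y, K)`.
For `𝔸 = (ξ, α)`, the components of `𝔸` are
* in `ℋ ⊕ ℋ*`: `A^h` with `A = (π_* ξ, α ∘ horLift)`, which is mapped to `(K A)^h`, where
  `(X + ω)^h` consists of the horizontal lift of `X` and the pull-back of `ω`;
* in `𝒱`: the vertical projection `V` of `ξ`, which is mapped to `𝒫_ε V`;
* in `𝒱*`: the restriction `φ` of `α` to vertical vectors, which is mapped to `-𝒫_ε* φ`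
  (a form on `𝒱` being extended by zero on `ℋ`).
These formulas make sense on the whole vector space containing `𝒢(E)`, and they preserve
`T𝒢(E) ⊕ T*𝒢(E)`. -/
def genStructure (Γ : X →L[ℝ] EndGen X) (p : EndGen X) (ε : Index) (K : EndGen X)
    (𝔸 : GenVec (Ambient X)) : GenVec (Ambient X) :=
  let A : GenVec X := (𝔸.1.1, 𝔸.2.comp (horLift Γ K))
  let V : EndGen X := verProj Γ K 𝔸.1
  let φ : EndGen X →L[ℝ] ℝ := 𝔸.2.comp (ContinuousLinearMap.inr ℝ X (EndGen X))
  (horLift Γ K (K A).1 + (0, fibreStructure p ε K V),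
    (K A).2.comp (ContinuousLinearMap.fst ℝ X (EndGen X)) -
      (φ.comp (fibreStructure p ε K)).comp (verProj Γ K))

end Structures

/-! ### Generalized metrics and metric connections on a manifold of dimension `2n` -/

/-- The model space `ℝ^{2n}`. -/
abbrev Model (n : ℕ) : Type := EuclideanSpace ℝ (Fin (2 * n))

/-- The model fibre of `TM ⊕ T*M`. -/
abbrev GenModel (n : ℕ) : Type := GenVec (Model n)

section Manifold

variable (n : ℕ) (M : Type*) [TopologicalSpace M] [ChartedSpace (Model n) M]

/-- The bundle `TM ⊕ T*M`. -/
abbrev GenTangent (x : M) : Type := GenVec (TangentSpace 𝓘(ℝ, Model n) x)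

variable [IsManifold 𝓘(ℝ, Model n) ∞ M]

/-- A generalized metric of signature `(n, n)` on `M`: a smooth subbundle of `TM ⊕ T*M` whose fibres
are generalized metrics of signature `(n, n)`. -/
structure GenMetric where
  fib : ∀ x : M, Submodule ℝ (GenTangent n M x)
  isGenMetric : ∀ x, IsGenMetric n (fib x)
  smooth : ∀ x₀ : M, ∃ U : Set M, IsOpen U ∧ x₀ ∈ U ∧
    ∃ s : Fin (2 * n) → ∀ x : M, GenTangent n M x,
      (∀ i, ContMDiffOn 𝓘(ℝ, Model n) (𝓘(ℝ, Model n).prod 𝓘(ℝ, GenModel n)) ∞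
        (fun x => TotalSpace.mk' (GenModel n) x (s i x)) U) ∧
      ∀ x ∈ U, fib x = Submodule.span ℝ (Set.range fun i => s i x)

variable {n M}

/-- Differentiability at `x` of a section of `TM ⊕ T*M`. -/
def SectionDiffAt (σ : ∀ x : M, GenTangent n M x) (x : M) : Prop :=
  MDifferentiableAt 𝓘(ℝ, Model n) (𝓘(ℝ, Model n).prod 𝓘(ℝ, GenModel n))
    (fun y => TotalSpace.mk' (GenModel n) y (σ y)) x

/-- A pair of smooth metric connections `D'` on `E' = E` and `D''` on `E'' = E^⊥`, given as the
connection `D = D' ⊕ D''` on `E' ⊕ E'' = TM ⊕ T*M`: a smooth connection on `TM ⊕ T*M` which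
preserves the subbundles `E'` and `E''` and is metric on each of them. -/
structure MetricConnections (E : GenMetric n M) where
  D : CovariantDerivative 𝓘(ℝ, Model n) (GenModel n) (GenTangent n M)
  smooth : ∀ U : Set M, IsOpen U → ContMDiffCovariantDerivativeOn (GenModel n) ∞ D.toFun U
  preserves : ∀ (σ : ∀ x, GenTangent n M x) (x : M), SectionDiffAt σ x →
    (∀ y, σ y ∈ E.fib y) → ∀ v, D σ x v ∈ E.fib x
  preserves_perp : ∀ (σ : ∀ x, GenTangent n M x) (x : M), SectionDiffAt σ x →
    (∀ y, σ y ∈ perp (E.fib y)) → ∀ v, D σ x v ∈ perp (E.fib x)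
  metric : ∀ (σ τ : ∀ x, GenTangent n M x) (x : M), SectionDiffAt σ x → SectionDiffAt τ x →
    ((∀ y, σ y ∈ E.fib y) ∧ (∀ y, τ y ∈ E.fib y) ∨
      (∀ y, σ y ∈ perp (E.fib y)) ∧ (∀ y, τ y ∈ perp (E.fib y))) →
    ∀ v, mvfderiv 𝓘(ℝ, Model n) (fun y => pairing (σ y) (τ y)) x v =
      pairing (D σ x v) (τ x) + pairing (σ x) (D τ x v)

/-! ### Coordinates

A chart `e` of `M` with domain `U` gives coordinates of `TM ⊕ T*M` over `U`, hence identifies the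
restriction to `U` of the bundle `End(TM ⊕ T*M)` with the open subset
`e(U) × End(ℝ^{2n} ⊕ (ℝ^{2n})*)` of the vector space `Ambient (Model n)`, and `𝒢(E)|U` with an
embedded submanifold of this vector space. -/

/-- The coordinate map `T_xM → ℝ^{2n}` of a chart. -/
def tangentCoord (e : OpenPartialHomeomorph M (Model n)) (x : M) :
    TangentSpace 𝓘(ℝ, Model n) x →L[ℝ] Model n :=
  mfderiv 𝓘(ℝ, Model n) 𝓘(ℝ, Model n) e x

/-- The coordinate frame `ℝ^{2n} → T_xM` of a chart (the inverse of `tangentCoord`). -/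
def tangentFrame (e : OpenPartialHomeomorph M (Model n)) (x : M) :
    Model n →L[ℝ] TangentSpace 𝓘(ℝ, Model n) x :=
  (tangentCoord e x).inverse

/-- The coordinate map `T_xM ⊕ T_x*M → ℝ^{2n} ⊕ (ℝ^{2n})*` of a chart. -/
def genCoord (e : OpenPartialHomeomorph M (Model n)) (x : M) :
    GenTangent n M x →ₗ[ℝ] GenModel n where
  toFun A := (tangentCoord e x A.1, A.2.comp (tangentFrame e x))
  map_add' A B := by ext <;> simp
  map_smul' c A := by ext <;> simp

/-- The coordinate frame `ℝ^{2n} ⊕ (ℝ^{2n})* → T_xM ⊕ T_x*M` of a chart. -/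
def genFrame (e : OpenPartialHomeomorph M (Model n)) (x : M) :
    GenModel n →ₗ[ℝ] GenTangent n M x where
  toFun A := (tangentFrame e x A.1, A.2.comp (tangentCoord e x))
  map_add' A B := by ext <;> simp
  map_smul' c A := by ext <;> simp

/-- The generalized reflector space `𝒢(E)` over the domain of the chart `e`, in coordinates. -/
def reflector (E : GenMetric n M) (e : OpenPartialHomeomorph M (Model n)) : Set (Ambient (Model n)) :=
  {a | a.1 ∈ e.target ∧
    genFrame e (e.symm a.1) ∘ₗ (a.2 : GenModel n →ₗ[ℝ] GenModel n) ∘ₗ genCoord e (e.symm a.1) ∈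
      compatible (E.fib (e.symm a.1))}

/-- The projection of `T_xM ⊕ T_x*M = E' ⊕ E''` onto `E'`. -/
def projE (E : GenMetric n M) (x : M) : GenTangent n M x →ₗ[ℝ] GenTangent n M x :=
  haveI : FiniteDimensional ℝ (GenTangent n M x) :=
    inferInstanceAs (FiniteDimensional ℝ (GenModel n))
  Submodule.projection (E.fib x) (perp (E.fib x)) (E.isGenMetric x).isCompl

/-- The projection onto `E'`, in coordinates at the point `y` of the coordinate domain. -/
def projCoord (E : GenMetric n M) (e : OpenPartialHomeomorph M (Model n)) (y : Model n) :
    EndGen (Model n) :=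
  LinearMap.toContinuousLinearMap
    (genCoord e (e.symm y) ∘ₗ projE E (e.symm y) ∘ₗ genFrame e (e.symm y))

/-- The connection form `Γ` of `D` in coordinates: `D_v w = Γ(v) w` for vectors `v` and elements
`w` of `ℝ^{2n} ⊕ (ℝ^{2n})*`, considered as a vector field and a section of `TM ⊕ T*M` with constant
coordinates. It is given by its values on the elements `w` of a basis. -/
def connForm {E : GenMetric n M} (D : MetricConnections E)
    (e : OpenPartialHomeomorph M (Model n)) (y : Model n) : Model n →L[ℝ] EndGen (Model n) :=
  bilinOfBasis (Module.finBasis ℝ (GenModel n)) fun i => LinearMap.toContinuousLinearMap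
    (genCoord e (e.symm y) ∘ₗ
      (D.D (fun x => genFrame e x (Module.finBasis ℝ (GenModel n) i)) (e.symm y) :
        TangentSpace 𝓘(ℝ, Model n) (e.symm y) →ₗ[ℝ] GenTangent n M (e.symm y)) ∘ₗ
      (tangentFrame e (e.symm y) :
        Model n →ₗ[ℝ] TangentSpace 𝓘(ℝ, Model n) (e.symm y)))

/-- `𝒦_ε` is integrable on `𝒢(E)`: its Nijenhuis tensor vanishes over the domain of every chart
of `M`. -/
def Integrable {E : GenMetric n M} (D : MetricConnections E) (ε : Index) : Prop :=
  ∀ e ∈ atlas (Model n) M, IsIntegrable (reflector E e)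
    (fun a => genStructure (connForm D e a.1) (projCoord E e a.1) ε a.2)

end Manifold

end GenReflector

end

/-! One component of the Nijenhuis tensor already obstructs integrability. In a chart, take a
constant element `A₀` of `T ⊕ T*`, its horizontal lift `A₀^h`, and a vertical field with value `V`
at `K`, and read off the component of `N(A₀^h, V)` in the tangent space of the base. The horizontal
part of `𝒦 A₀^h` at a point `K` is `K A₀`, which varies along the fibre, with derivative `V A₀`
along `V`; the connection coefficients enter only the fibre component, which `𝒦` does not mix into
the base one. What remains is the vector part of `K V A₀ - (𝒫_ε V) A₀`. This is
`fibreStructure_eq_of_isIntegrable`, with the brackets computed in `courant_vertical`.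

On `E'` the operator `𝒫_ε V` is `± K V`, and likewise on `E''`. Wherever the sign is `-1`,
integrability forces the vector part of `K V A₀` to vanish. Each of the indices 2, 3, 4 has the sign
`-1` on at least one of the two subbundles, so a contradiction needs only a point `K` and a vertical
`V` for which `K V` has nonzero vector part somewhere on `E'` and somewhere on `E''`.
`IsGenMetric.exists_vertical` writes them down in an orthonormal frame; rotating two frame vectors
into each other is where `n ≥ 2` enters.

The rest makes the test legitimate. In a chart the reflector space is the set of pairs `(y, K)` with
`K` skew, `K² = 1` and `K` commuting with the projection `P y` onto `E'`
(`reflector_eq_adaptedSet`). The projection is smooth (`contDiffOn_projCoord`), and a connection `D'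
⊕ D''` with metric summands has a skew connection form `Γ` with `dP = [P, Γ]` (`isSkew_connForm`,
`fderiv_projCoord`). These facts make the test fields tangent. Since tangent vectors are velocities
of curves in the set, `mem_tangentSet_adaptedSet` exhibits curves: block-diagonalise `K + tH` with
respect to `P`, then divide by a square root of its square. -/

noncomputable section

namespace GenReflector

/-! ### Chart coordinates on `TM ⊕ T*M`. -/

section Charts

variable {n : ℕ} {M : Type*} [TopologicalSpace M] [ChartedSpace (Model n) M]
  [IsManifold 𝓘(ℝ, Model n) ∞ M]

theorem continuousLinearMapAt_eq_tangentCoord {x₀ x : M}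
    (h : x ∈ (chartAt (Model n) x₀).source) :
    (trivializationAt (Model n) (TangentSpace 𝓘(ℝ, Model n)) x₀).continuousLinearMapAt ℝ x =
      tangentCoord (chartAt (Model n) x₀) x := by
  rw [TangentBundle.continuousLinearMapAt_trivializationAt (I := 𝓘(ℝ, Model n)) h]
  simp [tangentCoord]
  rfl

theorem symmL_eq_tangentFrame {x₀ x : M} (h : x ∈ (chartAt (Model n) x₀).source) :
    (trivializationAt (Model n) (TangentSpace 𝓘(ℝ, Model n)) x₀).symmL ℝ x =
      tangentFrame (chartAt (Model n) x₀) x := by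
  rw [tangentFrame, ← continuousLinearMapAt_eq_tangentCoord h]
  symm
  have h' : x ∈ (trivializationAt (Model n) (TangentSpace 𝓘(ℝ, Model n)) x₀).baseSet := by
    simpa using h
  apply ContinuousLinearMap.inverse_eq
  · ext1 v
    exact Trivialization.continuousLinearMapAt_symmL (R := ℝ) _ h' v
  · ext1 v
    exact Trivialization.symmL_continuousLinearMapAt (R := ℝ) _ h' v

/-- Bridge between smoothness of sections, defined by bundle trivializations, and the chart
coordinates used to define the reflector space. -/
theorem trivializationAt_snd_eq_genCoord {x₀ x : M} (h : x ∈ (chartAt (Model n) x₀).source)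
    (A : GenTangent n M x) :
    (trivializationAt (GenModel n) (GenTangent n M) x₀ ⟨x, A⟩).2 =
      genCoord (chartAt (Model n) x₀) x A := by
  have h' : x ∈ (trivializationAt (Model n) (TangentSpace 𝓘(ℝ, Model n)) x₀).baseSet := by
    simpa using h
  refine Prod.ext ?_ ?_
  · change (trivializationAt (Model n) (TangentSpace 𝓘(ℝ, Model n)) x₀ ⟨x, A.1⟩).2 =
      tangentCoord (chartAt (Model n) x₀) x A.1
    rw [← continuousLinearMapAt_eq_tangentCoord h, Trivialization.continuousLinearMapAt_apply,
      Trivialization.linearMapAt_apply, if_pos h']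
  · refine (congrArg Prod.snd (hom_trivializationAt_apply (RingHom.id ℝ) (F₁ := Model n)
      (F₂ := ℝ) (E₁ := TangentSpace 𝓘(ℝ, Model n)) (E₂ := Bundle.Trivial M ℝ) x₀
      ⟨x, A.2⟩)).trans ?_
    change _ = A.2.comp (tangentFrame (chartAt (Model n) x₀) x)
    rw [← symmL_eq_tangentFrame h]
    ext v
    simp [ContinuousLinearMap.inCoordinates]

theorem tangentCoord_tangentFrame {x₀ x : M} (h : x ∈ (chartAt (Model n) x₀).source)
    (v : Model n) :
    tangentCoord (chartAt (Model n) x₀) x (tangentFrame (chartAt (Model n) x₀) x v) = v := by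
  rw [← continuousLinearMapAt_eq_tangentCoord h, ← symmL_eq_tangentFrame h]
  exact Trivialization.continuousLinearMapAt_symmL (R := ℝ) _ (by simpa using h) v

theorem tangentFrame_tangentCoord {x₀ x : M} (h : x ∈ (chartAt (Model n) x₀).source)
    (v : TangentSpace 𝓘(ℝ, Model n) x) :
    tangentFrame (chartAt (Model n) x₀) x (tangentCoord (chartAt (Model n) x₀) x v) = v := by
  rw [← continuousLinearMapAt_eq_tangentCoord h, ← symmL_eq_tangentFrame h]
  exact Trivialization.symmL_continuousLinearMapAt (R := ℝ) _ (by simpa using h) v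

theorem genCoord_genFrame {x₀ x : M} (h : x ∈ (chartAt (Model n) x₀).source) (w : GenModel n) :
    genCoord (chartAt (Model n) x₀) x (genFrame (chartAt (Model n) x₀) x w) = w := by
  refine Prod.ext (tangentCoord_tangentFrame h w.1) ?_
  ext1 v
  exact congrArg w.2 (tangentCoord_tangentFrame h v)

theorem genFrame_genCoord {x₀ x : M} (h : x ∈ (chartAt (Model n) x₀).source)
    (A : GenTangent n M x) :
    genFrame (chartAt (Model n) x₀) x (genCoord (chartAt (Model n) x₀) x A) = A := by
  refine Prod.ext (tangentFrame_tangentCoord h A.1) ?_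
  ext1 v
  exact congrArg A.2 (tangentFrame_tangentCoord h v)

theorem pairing_genCoord {x₀ x : M} (h : x ∈ (chartAt (Model n) x₀).source)
    (A B : GenTangent n M x) :
    pairing (genCoord (chartAt (Model n) x₀) x A) (genCoord (chartAt (Model n) x₀) x B) =
      pairing A B := by
  change (1 / 2 : ℝ) * (A.2 (tangentFrame _ x (tangentCoord _ x B.1)) +
    B.2 (tangentFrame _ x (tangentCoord _ x A.1))) = (1 / 2 : ℝ) * (A.2 B.1 + B.2 A.1)
  rw [tangentFrame_tangentCoord h, tangentFrame_tangentCoord h]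

theorem pairing_genFrame {x₀ x : M} (h : x ∈ (chartAt (Model n) x₀).source)
    (w w' : GenModel n) :
    pairing (genFrame (chartAt (Model n) x₀) x w) (genFrame (chartAt (Model n) x₀) x w') =
      pairing w w' := by
  rw [← pairing_genCoord h, genCoord_genFrame h, genCoord_genFrame h]

/-- A section of `TM ⊕ T*M` in the coordinates of a chart. -/
def sectionCoord (e : OpenPartialHomeomorph M (Model n)) (σ : ∀ x : M, GenTangent n M x)
    (y : Model n) : GenModel n :=
  genCoord e (e.symm y) (σ (e.symm y))

theorem contMDiffOn_section_iff_contMDiffOn_genCoord {x₀ : M} {U : Set M} (hU : IsOpen U)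
    (hU' : U ⊆ (chartAt (Model n) x₀).source) {σ : ∀ x : M, GenTangent n M x} :
    ContMDiffOn 𝓘(ℝ, Model n) (𝓘(ℝ, Model n).prod 𝓘(ℝ, GenModel n)) ∞
        (fun x => TotalSpace.mk' (GenModel n) x (σ x)) U ↔
      ContMDiffOn 𝓘(ℝ, Model n) 𝓘(ℝ, GenModel n) ∞
        (fun x => genCoord (chartAt (Model n) x₀) x (σ x)) U := by
  have hb : U ⊆ (trivializationAt (GenModel n) (GenTangent n M) x₀).baseSet := by
    intro x hx
    have h := hU' hx
    simpa using h
  rw [Trivialization.contMDiffOn_section_iff (IB := 𝓘(ℝ, Model n)) (n := ∞)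
    (trivializationAt (GenModel n) (GenTangent n M) x₀) hU hb]
  exact contMDiffOn_congr fun x hx => trivializationAt_snd_eq_genCoord (hU' hx) (σ x)

theorem contMDiffOn_genFrame (x₀ : M) (w : GenModel n) :
    ContMDiffOn 𝓘(ℝ, Model n) (𝓘(ℝ, Model n).prod 𝓘(ℝ, GenModel n)) ∞
      (fun x => TotalSpace.mk' (GenModel n) x (genFrame (chartAt (Model n) x₀) x w))
      (chartAt (Model n) x₀).source := by
  rw [contMDiffOn_section_iff_contMDiffOn_genCoord (chartAt (Model n) x₀).open_source subset_rfl]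
  exact contMDiffOn_const.congr fun x hx => genCoord_genFrame hx w

theorem contDiffOn_sectionCoord {x₀ : M} {U : Set M} (hU : IsOpen U)
    (hU' : U ⊆ (chartAt (Model n) x₀).source) {σ : ∀ x : M, GenTangent n M x}
    (hσ : ContMDiffOn 𝓘(ℝ, Model n) (𝓘(ℝ, Model n).prod 𝓘(ℝ, GenModel n)) ∞
        (fun x => TotalSpace.mk' (GenModel n) x (σ x)) U) :
    ContDiffOn ℝ ∞ (sectionCoord (chartAt (Model n) x₀) σ)
      ((chartAt (Model n) x₀).target ∩ (chartAt (Model n) x₀).symm ⁻¹' U) := by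
  rw [contMDiffOn_section_iff_contMDiffOn_genCoord hU hU'] at hσ
  rw [← contMDiffOn_iff_contDiffOn]
  refine ContMDiffOn.comp hσ ?_ (fun y hy => hy.2)
  exact ((contMDiffOn_chart_symm (I := 𝓘(ℝ, Model n)) (x := x₀) (n := ∞))).mono
    Set.inter_subset_left

theorem sectionDiffAt_iff {x₀ x : M} (h : x ∈ (chartAt (Model n) x₀).source)
    {σ : ∀ x : M, GenTangent n M x} :
    SectionDiffAt σ x ↔ DifferentiableAt ℝ (sectionCoord (chartAt (Model n) x₀) σ)
      (chartAt (Model n) x₀ x) := by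
  have hb : x ∈ (trivializationAt (GenModel n) (GenTangent n M) x₀).baseSet := by
    simpa using h
  have hev : (fun z => (trivializationAt (GenModel n) (GenTangent n M) x₀ ⟨z, σ z⟩).2) =ᶠ[𝓝 x]
      fun z => genCoord (chartAt (Model n) x₀) z (σ z) := by
    filter_upwards [(chartAt (Model n) x₀).open_source.mem_nhds h] with z hz
    exact trivializationAt_snd_eq_genCoord hz _
  unfold SectionDiffAt
  rw [Trivialization.mdifferentiableAt_section_iff 𝓘(ℝ, Model n)
    (trivializationAt (GenModel n) (GenTangent n M) x₀) σ hb, hev.mdifferentiableAt_iff,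
    ← mdifferentiableAt_iff_differentiableAt]
  constructor
  · intro H
    refine MDifferentiableAt.comp _ (I' := 𝓘(ℝ, Model n)) (f := (chartAt (Model n) x₀).symm)
      (g := fun z => genCoord (chartAt (Model n) x₀) z (σ z)) ?_ ?_
    · rwa [(chartAt (Model n) x₀).left_inv h]
    · exact mdifferentiableAt_atlas_symm (chart_mem_atlas _ x₀)
        ((chartAt (Model n) x₀).map_source h)
  · intro H
    have := MDifferentiableAt.comp x (I' := 𝓘(ℝ, Model n)) H
      (mdifferentiableAt_atlas (chart_mem_atlas _ x₀) h)
    refine this.congr_of_eventuallyEq ?_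
    filter_upwards [(chartAt (Model n) x₀).open_source.mem_nhds h] with z hz
    simp only [Function.comp, sectionCoord]
    rw [(chartAt (Model n) x₀).left_inv hz]

end Charts

/-! ### Block-diagonal parts with respect to an idempotent. -/

section BlockDiag

variable {𝔸 : Type*} [Ring 𝔸]

/-- The block diagonal part of `h` with respect to the idempotent `p`. -/
def blockDiag (p h : 𝔸) : 𝔸 := p * h * p + (1 - p) * h * (1 - p)

theorem blockDiag_of_commute {p K : 𝔸} (hp : p * p = p) (h : Commute K p) :
    blockDiag p K = K := by
  have h' : K * p = p * K := h
  have e1 : p * K * p = p * K := by rw [← h', mul_assoc, hp]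
  simp only [blockDiag, mul_sub, sub_mul, mul_one, one_mul, e1, h']
  abel

theorem commute_blockDiag {p : 𝔸} (hp : p * p = p) (h : 𝔸) : Commute p (blockDiag p h) := by
  have e1 : p * (1 - p) = 0 := by rw [mul_sub, mul_one, hp, sub_self]
  have e2 : (1 - p) * p = 0 := by rw [sub_mul, one_mul, hp, sub_self]
  change p * blockDiag p h = blockDiag p h * p
  rw [blockDiag, mul_add, add_mul, ← mul_assoc, ← mul_assoc, hp, mul_assoc (p * h), hp,
    ← mul_assoc, ← mul_assoc, e1, mul_assoc _ (1 - p) p, e2]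
  simp

theorem commute_ringInverse {c r : 𝔸} (h : Commute c r) (hr : IsUnit r) :
    Commute c (Ring.inverse r) := by
  obtain ⟨u, rfl⟩ := hr
  rw [Ring.inverse_unit]
  exact h.units_inv_right

/-- Normalisation: `r` plays the role of `(k²)^{1/2}` and `u` of its inverse, so that `k u` is an
involution. -/
theorem mul_self_eq_one_of_mul_self_eq {k r u : 𝔸} (h : r * r = k * k) (hr : r * u = 1)
    (hk : Commute k u) : k * u * (k * u) = 1 := by
  have hk' : k * u = u * k := hk
  calc k * u * (k * u) = k * (u * k) * u := by simp only [mul_assoc]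
    _ = k * k * u * u := by rw [← hk']; simp only [mul_assoc]
    _ = r * (r * u) * u := by rw [← h]; simp only [mul_assoc]
    _ = 1 := by rw [hr, mul_one, hr]

end BlockDiag

/-! ### Square roots near the identity and curves of involutions. -/

section SquareRoot

variable {𝔸 : Type*} [NormedRing 𝔸] [NormedAlgebra ℝ 𝔸]

/-- The commutator `x = [c, r]` satisfies `r x + x r = 0`, that is `2x = (1 - r) x + x (1 - r)`;
since `‖1 - r‖ < 1` this forces `x = 0`. Thus the square root inherits commutation relations without
being given by a power series. -/
theorem commute_of_commute_mul_self {c r : 𝔸} (hr : ‖1 - r‖ < 1) (h : Commute c (r * r)) :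
    Commute c r := by
  set x := c * r - r * c with hx
  have h1 : r * x + x * r = 0 := by
    have h' : c * (r * r) = r * r * c := h
    rw [hx]
    linear_combination (norm := noncomm_ring) h'
  have h2 : x + x = (1 - r) * x + x * (1 - r) := by
    linear_combination (norm := noncomm_ring) h1
  have h3 : ‖x + x‖ ≤ ‖1 - r‖ * ‖x‖ + ‖x‖ * ‖1 - r‖ := by
    rw [h2]
    exact (norm_add_le _ _).trans (add_le_add (norm_mul_le _ _) (norm_mul_le _ _))
  have h4 : ‖x + x‖ = 2 * ‖x‖ := by
    rw [← two_smul ℝ x, norm_smul]; simp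
  have h5 : x = 0 := by
    by_contra hne
    have := norm_pos_iff.2 hne
    nlinarith
  exact sub_eq_zero.1 h5

theorem hasStrictFDerivAt_mul_self_one :
    HasStrictFDerivAt (fun x : 𝔸 => x * x)
      ((ContinuousLinearEquiv.smulLeft (Units.mk0 (2 : ℝ) two_ne_zero) : 𝔸 ≃L[ℝ] 𝔸) : 𝔸 →L[ℝ] 𝔸)
      1 := by
  have h := (hasStrictFDerivAt_id (𝕜 := ℝ) (1 : 𝔸)).mul' (hasStrictFDerivAt_id (𝕜 := ℝ) (1 : 𝔸))
  refine h.congr_fderiv ?_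
  ext v
  simp [two_smul, Units.smul_def]

/-- Squaring has the invertible derivative `2` at `1`, so the inverse function theorem gives a local
square root; the chain rule transports the vanishing derivative of `s` to it. -/
theorem exists_sqrt_of_hasDerivAt [CompleteSpace 𝔸] {s : ℝ → 𝔸} (h0 : s 0 = 1)
    (hs : HasDerivAt s 0 0) :
    ∃ r : ℝ → 𝔸, r 0 = 1 ∧ HasDerivAt r 0 0 ∧ ∀ᶠ t in 𝓝 (0 : ℝ), r t * r t = s t := by
  have hf := hasStrictFDerivAt_mul_self_one (𝔸 := 𝔸)
  refine ⟨fun t => hf.localInverse _ _ _ (s t), ?_, ?_, ?_⟩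
  · have := hf.localInverse_apply_image
    simp only [mul_one] at this
    simpa [h0] using this
  · have h1 := hf.to_localInverse.hasFDerivAt
    simp only [mul_one] at h1
    have h2 := h1.comp_hasDerivAt_of_eq (0 : ℝ) hs h0.symm
    rw [map_zero] at h2
    exact h2
  · have h1 := hf.eventually_right_inverse
    have h2 : Filter.Tendsto s (𝓝 0) (𝓝 ((1 : 𝔸) * 1)) := by
      have := hs.continuousAt.tendsto
      rwa [h0, ← mul_one (1 : 𝔸)] at this
    exact h2.eventually h1

/-- The hypothesis `hcomm` is the linearisation of `K p = p K` in the direction `(H, p')`. It says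
that the off-diagonal part of `K + tH` vanishes to first order, so discarding that part does not
change the velocity. -/
theorem hasDerivAt_blockDiag {p : ℝ → 𝔸} {p' K H : 𝔸} (hpd : HasDerivAt p p' 0)
    (hpp : ∀ᶠ t in 𝓝 (0 : ℝ), p t * p t = p t) (hKp : Commute K (p 0))
    (hcomm : H * p 0 + K * p' = p 0 * H + p' * K) :
    HasDerivAt (fun t : ℝ => blockDiag (p t) (K + t • H)) H 0 := by
  have hKp' : K * p 0 = p 0 * K := hKp
  -- Differentiate `p² = p`.
  have hd : p' * p 0 + p 0 * p' = p' :=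
    (hpd.mul hpd).unique (hpd.congr_of_eventuallyEq hpp)
  have hhd : HasDerivAt (fun t : ℝ => K + t • H) H 0 :=
    (((hasDerivAt_id (0 : ℝ)).smul_const H).const_add K).congr_deriv (one_smul _ _)
  have h1 := ((hpd.mul hhd).mul hpd).add (((hpd.const_sub 1).mul hhd).mul (hpd.const_sub 1))
  refine h1.congr_deriv ?_
  simp only [Pi.mul_apply, zero_smul, add_zero]
  have hp0 : p 0 * p 0 = p 0 := hpp.self_of_nhds
  generalize p 0 = q at *
  have e1 : q * H * q - q * H = q * p' * K - q * K * p' := by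
    linear_combination (norm := noncomm_ring) q * hcomm + hp0 * H
  have e2 : H * q - q * H * q = p' * K * q - K * p' * q := by
    linear_combination (norm := noncomm_ring) hcomm * q - H * hp0
  linear_combination (norm := noncomm_ring) e1 - e2 + p' * hKp' + hd * K + K * hd - hKp' * p'

/-- Since `H` anticommutes with `K`, the square of the block-diagonal curve has derivative `HK + KH
= 0` at `0`. Its square root `r` is therefore stationary there, and dividing by `r` keeps the
velocity `H`. -/
theorem exists_curve [CompleteSpace 𝔸] {p : ℝ → 𝔸} {p' K H : 𝔸} (hpd : HasDerivAt p p' 0)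
    (hpp : ∀ᶠ t in 𝓝 (0 : ℝ), p t * p t = p t) (hKK : K * K = 1) (hKp : Commute K (p 0))
    (hanti : H * K + K * H = 0) (hcomm : H * p 0 + K * p' = p 0 * H + p' * K) :
    ∃ r : ℝ → 𝔸, r 0 = 1 ∧
      HasDerivAt (fun t : ℝ => blockDiag (p t) (K + t • H) * Ring.inverse (r t)) H 0 ∧
      ∀ᶠ t in 𝓝 (0 : ℝ), IsUnit (r t) ∧ ‖1 - r t‖ < 1 ∧
        r t * r t = blockDiag (p t) (K + t • H) * blockDiag (p t) (K + t • H) := by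
  have hk := hasDerivAt_blockDiag hpd hpp hKp hcomm
  have hk0 : blockDiag (p 0) (K + (0 : ℝ) • H) = K := by
    rw [zero_smul, add_zero, blockDiag_of_commute hpp.self_of_nhds hKp]
  have hs := hk.mul hk
  rw [hk0, hanti] at hs
  obtain ⟨r, hr0, hrd, hr⟩ := exists_sqrt_of_hasDerivAt (by rw [Pi.mul_apply, hk0, hKK]) hs
  refine ⟨r, hr0, ?_, ?_⟩
  · have h1 := hasFDerivAt_ringInverse (𝕜 := ℝ) (1 : 𝔸ˣ)
    have h2 := h1.comp_hasDerivAt_of_eq (0 : ℝ) hrd (by rw [hr0, Units.val_one])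
    rw [map_zero] at h2
    have h3 := hk.mul h2
    refine h3.congr_deriv ?_
    simp [hr0]
  · have h1 : ∀ᶠ t in 𝓝 (0 : ℝ), ‖1 - r t‖ < 1 := by
      have : Filter.Tendsto (fun t => ‖1 - r t‖) (𝓝 0) (𝓝 ‖1 - r 0‖) :=
        (continuousAt_const.sub hrd.continuousAt).norm
      rw [hr0, sub_self, norm_zero] at this
      exact this.eventually_lt_const one_pos
    filter_upwards [h1, hr] with t ht1 ht2
    refine ⟨?_, ht1, ht2⟩
    have := isUnit_one_sub_of_norm_lt_one ht1
    rwa [sub_sub_cancel] at this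

end SquareRoot

/-! ### Symmetry of square roots for a bilinear form. -/

section SymmetricSquareRoot

variable {F : Type*} [NormedAddCommGroup F] [NormedSpace ℝ F]

instance : NormedAddCommGroup (F →L[ℝ] F →L[ℝ] ℝ) := ContinuousLinearMap.toNormedAddCommGroup
instance : SeminormedAddCommGroup (F →L[ℝ] F →L[ℝ] ℝ) :=
  ContinuousLinearMap.toSeminormedAddCommGroup
instance : NormedSpace ℝ (F →L[ℝ] F →L[ℝ] ℝ) := ContinuousLinearMap.toNormedSpace

/-- The contraction argument of `commute_of_commute_mul_self`, applied to the defect form `β(A, B) =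
b(rA, B) - b(A, rB)`: symmetry of `r²` gives `β(rA, B) + β(A, rB) = 0`, hence `‖2β‖ ≤ 2 ‖1 - r‖
‖β‖`. -/
theorem apply_comm_of_apply_comm_mul_self (b : F →L[ℝ] F →L[ℝ] ℝ) {r : F →L[ℝ] F}
    (hr : ‖1 - r‖ < 1) (h : ∀ u v, b ((r * r) u) v = b u ((r * r) v)) (u v : F) :
    b (r u) v = b u (r v) := by
  set L := ContinuousLinearMap.compL ℝ F F ℝ with hL
  set β : F →L[ℝ] F →L[ℝ] ℝ := b.comp r - (L.flip r).comp b with hβ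
  have hβa : ∀ A B, β A B = b (r A) B - b A (r B) := fun A B => rfl
  have h1 : ∀ A B, β (r A) B + β A (r B) = 0 := by
    intro A B
    have := h A B
    simp only [mul_apply_eq_comp] at this
    rw [hβa, hβa]
    linarith
  have h2 : β + β = β.comp (1 - r) + (L.flip (1 - r)).comp β := by
    ext A B
    have h3 : β (A - r A) B = β A B - β (r A) B := by rw [map_sub]; rfl
    have h4 : β A (B - r B) = β A B - β A (r B) := map_sub _ _ _
    change β A B + β A B = β (A - r A) B + β A (B - r B)
    linarith [h1 A B]
  have h3 : ‖β + β‖ ≤ ‖β‖ * ‖1 - r‖ + ‖1 - r‖ * ‖β‖ := by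
    rw [h2]
    refine (norm_add_le _ _).trans (add_le_add (ContinuousLinearMap.opNorm_comp_le _ _) ?_)
    refine ContinuousLinearMap.opNorm_le_bound _ (by positivity) fun A => ?_
    change ‖(β A).comp (1 - r)‖ ≤ _
    refine (ContinuousLinearMap.opNorm_comp_le _ _).trans ?_
    rw [mul_comm, mul_assoc]
    exact mul_le_mul_of_nonneg_left (β.le_opNorm A) (norm_nonneg _)
  have h4 : ‖β + β‖ = 2 * ‖β‖ := by
    rw [← two_smul ℝ β, norm_smul]; simp
  have h5 : β = 0 := by
    by_contra hne
    have := norm_pos_iff.2 hne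
    nlinarith
  have := hβa u v
  rw [h5] at this
  exact (sub_eq_zero.1 this.symm)

end SymmetricSquareRoot

/-! ### The model of the reflector space and its tangent vectors. -/

section AdaptedSet

variable {X : Type*} [NormedAddCommGroup X] [NormedSpace ℝ X]

instance : NormedRing (EndGen X) := ContinuousLinearMap.toNormedRing
instance : Ring (EndGen X) := inferInstance
instance : Monoid (EndGen X) := inferInstance
instance : MonoidWithZero (EndGen X) := inferInstance
instance : MulOneClass (EndGen X) := inferInstance
instance : Semigroup (EndGen X) := inferInstance
instance : Mul (EndGen X) := inferInstance
instance : MulZeroClass (EndGen X) := MulZeroOneClass.toMulZeroClass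
instance : AddGroup (EndGen X) := AddCommGroup.toAddGroup
instance : SubNegMonoid (EndGen X) := AddGroup.toSubNegMonoid
instance : AddMonoid (EndGen X) := SubNegMonoid.toAddMonoid
instance : AddZeroClass (EndGen X) := AddMonoid.toAddZeroClass

/-- Skew-symmetry for the neutral metric. -/
def IsSkew (K : EndGen X) : Prop := ∀ A B, pairing (K A) B + pairing A (K B) = 0

/-- Symmetry for the neutral metric. -/
def IsSymm (K : EndGen X) : Prop := ∀ A B, pairing (K A) B = pairing A (K B)

theorem IsSkew.apply_left {K : EndGen X} (h : IsSkew K) (A B : GenVec X) :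
    pairing (K A) B = -pairing A (K B) := eq_neg_of_add_eq_zero_left (h A B)

theorem IsSymm.one_sub {p : EndGen X} (h : IsSymm p) : IsSymm (1 - p) := by
  intro A B
  change pairing (A - p A) B = pairing A (B - p B)
  rw [map_sub, map_sub, LinearMap.sub_apply, h]

theorem IsSkew.add {K L : EndGen X} (hK : IsSkew K) (hL : IsSkew L) : IsSkew (K + L) := by
  intro A B
  simp only [add_apply, map_add, LinearMap.add_apply]
  linear_combination hK A B + hL A B

theorem IsSkew.smul {K : EndGen X} (hK : IsSkew K) (c : ℝ) : IsSkew (c • K) := by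
  intro A B
  simp only [smul_apply, map_smul, LinearMap.smul_apply, smul_eq_mul]
  linear_combination c * hK A B

theorem IsSkew.conj {K p : EndGen X} (hK : IsSkew K) (hp : IsSymm p) : IsSkew (p * K * p) := by
  intro A B
  simp only [mul_apply_eq_comp]
  rw [hp, ← hp A]
  exact hK _ _

theorem IsSkew.blockDiag {K p : EndGen X} (hK : IsSkew K) (hp : IsSymm p) :
    IsSkew (blockDiag p K) :=
  (hK.conj hp).add (hK.conj hp.one_sub)

theorem IsSkew.conj_skew {K L : EndGen X} (hK : IsSkew K) (hL : IsSkew L) :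
    IsSkew (L * K * L) := by
  intro A B
  simp only [mul_apply_eq_comp]
  rw [hL.apply_left, hK.apply_left, hL.apply_left]
  ring

theorem IsSkew.isSymm_mul_self {K : EndGen X} (hK : IsSkew K) : IsSymm (K * K) := by
  intro A B
  simp only [mul_apply_eq_comp]
  rw [hK.apply_left, hK.apply_left, neg_neg]

theorem IsSkew.mul_isSymm {K r : EndGen X} (hK : IsSkew K) (hr : IsSymm r) (h : Commute K r) :
    IsSkew (K * r) := by
  intro A B
  have h' : K * r = r * K := h
  nth_rewrite 2 [h']
  simp only [mul_apply_eq_comp]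
  rw [← hr]
  exact hK _ _

theorem IsSymm.ringInverse {r : EndGen X} (hr : IsSymm r) (hu : IsUnit r) :
    IsSymm (Ring.inverse r) := by
  intro A B
  have h1 : ∀ C, r (Ring.inverse r C) = C := fun C =>
    DFunLike.congr_fun (Ring.mul_inverse_cancel r hu) C
  rw [← h1 B, ← hr, h1, h1]

/-- The neutral metric as a continuous bilinear map. -/
def pairingL : GenVec X →L[ℝ] GenVec X →L[ℝ] ℝ :=
  LinearMap.mkContinuous₂ pairing 1 fun A B => by
    have h1 : ‖A.2 B.1‖ ≤ ‖A‖ * ‖B‖ := (A.2.le_opNorm _).trans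
      (mul_le_mul (norm_snd_le A) (norm_fst_le B) (norm_nonneg _) (norm_nonneg _))
    have h2 : ‖B.2 A.1‖ ≤ ‖B‖ * ‖A‖ := (B.2.le_opNorm _).trans
      (mul_le_mul (norm_snd_le B) (norm_fst_le A) (norm_nonneg _) (norm_nonneg _))
    have h3 := norm_add_le (A.2 B.1) (B.2 A.1)
    change ‖(1 / 2 : ℝ) * (A.2 B.1 + B.2 A.1)‖ ≤ _
    rw [norm_mul, Real.norm_of_nonneg (by norm_num : (0 : ℝ) ≤ 1 / 2)]
    linarith [mul_comm ‖A‖ ‖B‖]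

theorem isSymm_of_isSymm_mul_self {r : EndGen X} (hr : ‖1 - r‖ < 1) (h : IsSymm (r * r)) :
    IsSymm r :=
  apply_comm_of_apply_comm_mul_self pairingL hr h

/-- The pairs `(y, K)` with `y ∈ U` and `K` a skew-symmetric product structure of `X ⊕ X*`
commuting with `P y`. -/
def adaptedSet (U : Set X) (P : X → EndGen X) : Set (Ambient X) :=
  {a | a.1 ∈ U ∧ a.2 * a.2 = 1 ∧ IsSkew a.2 ∧ Commute a.2 (P a.1)}

/-- The conditions on `ξ` are the linearised equations of the set. The curve `k r⁻¹`, with `k` the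
block-diagonal part of `K + tH` over a straight line in the base and `r² = k²`, realises any such
`ξ` as a velocity. -/
theorem mem_tangentSet_adaptedSet [FiniteDimensional ℝ X] {U : Set X} (hU : IsOpen U)
    {P : X → EndGen X}
    (hPP : ∀ y ∈ U, P y * P y = P y) (hPs : ∀ y ∈ U, IsSymm (P y)) {a : Ambient X}
    (ha : a ∈ adaptedSet U P) {P' : X →L[ℝ] EndGen X} (hP : HasFDerivAt P P' a.1)
    {ξ : Ambient X} (hs : IsSkew ξ.2) (hanti : ξ.2 * a.2 + a.2 * ξ.2 = 0)
    (hcomm : ξ.2 * P a.1 + a.2 * P' ξ.1 = P a.1 * ξ.2 + P' ξ.1 * a.2) :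
    ξ ∈ tangentSet (adaptedSet U P) a := by
  obtain ⟨haU, hKK, hKs, hKP⟩ := ha
  have hyd : HasDerivAt (fun t : ℝ => a.1 + t • ξ.1) ξ.1 0 :=
    (((hasDerivAt_id (0 : ℝ)).smul_const ξ.1).const_add a.1).congr_deriv (one_smul _ _)
  have hy0 : a.1 + (0 : ℝ) • ξ.1 = a.1 := by simp
  have hyU : ∀ᶠ t in 𝓝 (0 : ℝ), a.1 + t • ξ.1 ∈ U :=
    hyd.continuousAt.eventually_mem (hU.mem_nhds (by rwa [hy0]))
  have hpd : HasDerivAt (fun t : ℝ => P (a.1 + t • ξ.1)) (P' ξ.1) 0 := by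
    have : HasFDerivAt P P' (a.1 + (0 : ℝ) • ξ.1) := by rwa [hy0]
    exact this.comp_hasDerivAt 0 hyd
  have : FiniteDimensional ℝ (GenVec X) := inferInstance
  have : CompleteSpace (GenVec X) := FiniteDimensional.complete ℝ _
  obtain ⟨r, hr0, hrd, hr⟩ := exists_curve (K := a.2) (H := ξ.2) hpd
    (hyU.mono fun t ht => hPP _ ht) hKK (by simpa only [hy0] using hKP) hanti
    (by simpa only [hy0] using hcomm)
  refine ⟨fun t => (a.1 + t • ξ.1, blockDiag (P (a.1 + t • ξ.1)) (a.2 + t • ξ.2) *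
    Ring.inverse (r t)), ?_, ?_, hyd.prodMk hrd⟩
  · refine Prod.ext hy0 ?_
    change blockDiag (P (a.1 + (0 : ℝ) • ξ.1)) (a.2 + (0 : ℝ) • ξ.2) * Ring.inverse (r 0) = a.2
    rw [hr0, Ring.inverse_one, mul_one, hy0, zero_smul, add_zero,
      blockDiag_of_commute (hPP _ haU) hKP]
  · filter_upwards [hyU, hr] with t htU ht
    obtain ⟨hu, hn, hrr⟩ := ht
    have hsk : IsSkew (blockDiag (P (a.1 + t • ξ.1)) (a.2 + t • ξ.2)) :=
      (hKs.add (hs.smul t)).blockDiag (hPs _ htU)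
    have hcp := commute_blockDiag (hPP _ htU) (a.2 + t • ξ.2)
    generalize blockDiag (P (a.1 + t • ξ.1)) (a.2 + t • ξ.2) = k at *
    -- The root commutes with `k` and with the projection because its square `k²` does, and is
    -- symmetric because the square of a skew map is. Hence `k r⁻¹` stays skew and adapted.
    have hkr : Commute k (r t) := by
      apply commute_of_commute_mul_self hn
      rw [hrr]
      exact (Commute.refl k).mul_right (Commute.refl k)
    have hpr : Commute (P (a.1 + t • ξ.1)) (r t) := by
      apply commute_of_commute_mul_self hn
      rw [hrr]
      exact hcp.mul_right hcp
    have hrs : IsSymm (r t) := isSymm_of_isSymm_mul_self hn (by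
      rw [hrr]; exact hsk.isSymm_mul_self)
    have inv_comm : ∀ c : EndGen X, Commute c (r t) → Commute c (Ring.inverse (r t)) :=
      fun c hc => commute_ringInverse hc hu
    refine ⟨htU, ?_, hsk.mul_isSymm (hrs.ringInverse hu) (inv_comm _ hkr), ?_⟩
    · exact mul_self_eq_one_of_mul_self_eq hrr (Ring.mul_inverse_cancel _ hu) (inv_comm _ hkr)
    · exact (hcp.mul_right (inv_comm _ hpr)).symm

end AdaptedSet

/-! ### Courant brackets with vertical fields. -/

section CourantVertical

variable {X Z : Type*} [NormedAddCommGroup X] [NormedSpace ℝ X]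
  [NormedAddCommGroup Z] [NormedSpace ℝ Z]

/-- A vertical field pairs to zero with a form pulled back fibrewise from the base, so the exact
term of the bracket drops out and only derivatives of `f` and `θ` along `V` survive. The fibre
component, which involves `g`, is left uncomputed because the base component of `N` does not see it.
-/
theorem courant_vertical {f : X × Z → X} {g : X × Z → Z} {θ : X × Z → X →L[ℝ] ℝ}
    {V : X × Z → Z} {a : X × Z} {f' : X × Z →L[ℝ] X} {θ' : X × Z →L[ℝ] X →L[ℝ] ℝ}
    (hf : HasFDerivAt f f' a) (hg : DifferentiableAt ℝ g a) (hθ : HasFDerivAt θ θ' a)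
    (hV : DifferentiableAt ℝ V a) :
    (courant (fun b => ((f b, g b), (θ b).comp (ContinuousLinearMap.fst ℝ X Z)))
        (fun b => ((0, V b), 0)) a).1.1 = -f' (0, V a) ∧
      (courant (fun b => ((f b, g b), (θ b).comp (ContinuousLinearMap.fst ℝ X Z)))
        (fun b => ((0, V b), 0)) a).2 =
        -(θ' (0, V a)).comp (ContinuousLinearMap.fst ℝ X Z) := by
  have h1 : HasFDerivAt (fun b => (f b, g b)) (f'.prod (fderiv ℝ g a)) a :=
    hf.prodMk hg.hasFDerivAt
  have h2 : HasFDerivAt (fun b => ((0 : X), V b))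
      ((0 : X × Z →L[ℝ] X).prod (fderiv ℝ V a)) a :=
    (hasFDerivAt_const _ _).prodMk hV.hasFDerivAt
  have h3 : HasFDerivAt (fun b => (θ b).comp (ContinuousLinearMap.fst ℝ X Z))
      ((((ContinuousLinearMap.compL ℝ (X × Z) X ℝ).flip (ContinuousLinearMap.fst ℝ X Z)).comp
        θ')) a :=
    ((ContinuousLinearMap.compL ℝ (X × Z) X ℝ).flip
      (ContinuousLinearMap.fst ℝ X Z)).hasFDerivAt.comp a hθ
  constructor
  · simp only [courant, VectorField.lieBracket, h1.fderiv, h2.fderiv]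
    simp
  · simp only [courant, lieDerivForm, h1.fderiv, h2.fderiv, h3.fderiv]
    ext ξ <;> simp

end CourantVertical

/-! ### Vertical and horizontal test fields, their tangency and smoothness. -/

section Fields

variable {X : Type*} [NormedAddCommGroup X] [NormedSpace ℝ X]

/-- The extension of a vertical vector `V₀` to a vertical vector field. -/
def verticalField (P : X → EndGen X) (V₀ : EndGen X) (b : Ambient X) : EndGen X :=
  (1 / 2 : ℝ) • (blockDiag (P b.1) V₀ - b.2 * blockDiag (P b.1) V₀ * b.2)

/-- For `K² = 1` the map `W ↦ ½ (W - K W K)` projects onto the endomorphisms anticommuting with `K`,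
and `blockDiag` projects onto those commuting with `P`; a vertical vector is fixed by both. -/
theorem verticalField_eq {P : X → EndGen X} {V₀ : EndGen X} {b : Ambient X}
    (hP : P b.1 * P b.1 = P b.1) (hK : b.2 * b.2 = 1) (hV : V₀ * b.2 + b.2 * V₀ = 0)
    (hc : Commute V₀ (P b.1)) : verticalField P V₀ b = V₀ := by
  have h1 : b.2 * V₀ = -(V₀ * b.2) := eq_neg_of_add_eq_zero_right hV
  rw [verticalField, blockDiag_of_commute hP hc, h1, neg_mul, mul_assoc, hK, mul_one,
    sub_neg_eq_add, ← two_smul ℝ V₀, smul_smul]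
  norm_num

theorem isSkew_verticalField {P : X → EndGen X} {V₀ : EndGen X} {b : Ambient X}
    (hP : IsSymm (P b.1)) (hK : IsSkew b.2) (hV : IsSkew V₀) :
    IsSkew (verticalField P V₀ b) := by
  have h1 := hV.blockDiag hP
  have h2 := (h1.conj_skew hK).smul (-1)
  rw [neg_one_smul] at h2
  have h3 := (h1.add h2).smul (1 / 2)
  rwa [← sub_eq_add_neg] at h3

theorem verticalField_anticommute {P : X → EndGen X} {V₀ : EndGen X} {b : Ambient X}
    (hK : b.2 * b.2 = 1) :
    verticalField P V₀ b * b.2 + b.2 * verticalField P V₀ b = 0 := by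
  rw [verticalField, smul_mul_assoc, mul_smul_comm, ← smul_add]
  generalize blockDiag (P b.1) V₀ = W
  have : (W - b.2 * W * b.2) * b.2 + b.2 * (W - b.2 * W * b.2) = 0 := by
    rw [sub_mul, mul_sub, mul_assoc (b.2 * W), hK, mul_one, mul_assoc b.2 W, ← mul_assoc b.2 b.2,
      hK, one_mul]
    abel
  rw [this, smul_zero]

theorem commute_verticalField {P : X → EndGen X} {V₀ : EndGen X} {b : Ambient X}
    (hP : P b.1 * P b.1 = P b.1) (hc : Commute b.2 (P b.1)) :
    Commute (verticalField P V₀ b) (P b.1) := by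
  have h1 := (commute_blockDiag hP V₀).symm
  exact (h1.sub_left ((hc.mul_left h1).mul_left hc)).smul_left _

theorem vertical_mem_tangentSet [FiniteDimensional ℝ X] {U : Set X} (hU : IsOpen U)
    {P : X → EndGen X} (hPd : ∀ y ∈ U, DifferentiableAt ℝ P y)
    (hPP : ∀ y ∈ U, P y * P y = P y) (hPs : ∀ y ∈ U, IsSymm (P y)) {a : Ambient X}
    (ha : a ∈ adaptedSet U P) {V : EndGen X} (hs : IsSkew V) (hanti : V * a.2 + a.2 * V = 0)
    (hc : Commute V (P a.1)) : ((0, V) : Ambient X) ∈ tangentSet (adaptedSet U P) a := by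
  refine mem_tangentSet_adaptedSet hU hPP hPs ha (hPd _ ha.1).hasFDerivAt hs hanti ?_
  simp only [map_zero, mul_zero, zero_mul, add_zero]
  exact hc

theorem horLift_mem_tangentSet [FiniteDimensional ℝ X] {U : Set X} (hU : IsOpen U)
    {P : X → EndGen X} (hPd : ∀ y ∈ U, DifferentiableAt ℝ P y)
    (hPP : ∀ y ∈ U, P y * P y = P y) (hPs : ∀ y ∈ U, IsSymm (P y)) {a : Ambient X}
    (ha : a ∈ adaptedSet U P) {Γ : X →L[ℝ] EndGen X}
    (hΓ : ∀ v, fderiv ℝ P a.1 v = P a.1 * Γ v - Γ v * P a.1)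
    (hs : ∀ v, IsSkew (Γ v)) (x : X) :
    horLift Γ a.2 x ∈ tangentSet (adaptedSet U P) a := by
  have hH : horLift Γ a.2 x = (x, a.2 * Γ x - Γ x * a.2) := by
    rw [horLift_apply, neg_sub]; rfl
  rw [hH]
  have hKP : a.2 * P a.1 = P a.1 * a.2 := ha.2.2.2
  have hKK := ha.2.1
  refine mem_tangentSet_adaptedSet hU hPP hPs ha (hPd _ ha.1).hasFDerivAt ?_ ?_ ?_
  · intro A B
    change pairing (a.2 (Γ x A) - Γ x (a.2 A)) B + pairing A (a.2 (Γ x B) - Γ x (a.2 B)) = 0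
    have hK := ha.2.2.1
    simp only [map_sub, LinearMap.sub_apply]
    rw [hK.apply_left, (hs x).apply_left, (hs x).apply_left, hK.apply_left]
    ring
  · change (a.2 * Γ x - Γ x * a.2) * a.2 + a.2 * (a.2 * Γ x - Γ x * a.2) = 0
    rw [sub_mul, mul_sub, mul_assoc (Γ x), hKK, ← mul_assoc a.2 a.2, hKK, mul_assoc a.2]
    simp
  · change (a.2 * Γ x - Γ x * a.2) * P a.1 + a.2 * fderiv ℝ P a.1 x =
      P a.1 * (a.2 * Γ x - Γ x * a.2) + fderiv ℝ P a.1 x * a.2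
    rw [hΓ]
    simp only [sub_mul, mul_sub, mul_assoc]
    rw [hKP]
    simp only [← mul_assoc]
    rw [hKP]
    abel

theorem contDiffOn_verticalField {U : Set X} {P : X → EndGen X} (hP : ContDiffOn ℝ ∞ P U)
    (V₀ : EndGen X) : ContDiffOn ℝ ∞ (verticalField P V₀) (U ×ˢ Set.univ) := by
  have h1 : ContDiffOn ℝ ∞ (fun b : Ambient X => P b.1) (U ×ˢ Set.univ) :=
    hP.comp contDiff_fst.contDiffOn fun b hb => hb.1
  have h2 : ContDiffOn ℝ ∞ (fun b : Ambient X => b.2) (U ×ˢ Set.univ) := contDiff_snd.contDiffOn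
  have h3 : ContDiffOn ℝ ∞ (fun b : Ambient X => 1 - P b.1) (U ×ˢ Set.univ) :=
    contDiffOn_const.sub h1
  have h4 : ContDiffOn ℝ ∞ (fun b : Ambient X => blockDiag (P b.1) V₀) (U ×ˢ Set.univ) :=
    ((h1.clm_comp contDiffOn_const).clm_comp h1).add ((h3.clm_comp contDiffOn_const).clm_comp h3)
  exact (h4.sub ((h2.clm_comp h4).clm_comp h2)).const_smul _

theorem contDiffOn_fibreStructure {O : Set (Ambient X)} {P V : Ambient X → EndGen X}
    (hP : ContDiffOn ℝ ∞ P O) (hV : ContDiffOn ℝ ∞ V O) (ε : Index) :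
    ContDiffOn ℝ ∞ (fun b => fibreStructure (P b) ε b.2 (V b)) O := by
  have h : ContDiffOn ℝ ∞ (fun b => (b.2.comp (V b)).comp
      (ε.sgn₁ • P b + ε.sgn₂ • (ContinuousLinearMap.id ℝ (GenVec X) - P b))) O :=
    (contDiff_snd.contDiffOn.clm_comp hV).clm_comp
      ((hP.const_smul _).add ((contDiffOn_const.sub hP).const_smul _))
  exact h

theorem contDiffOn_horLift {O : Set (Ambient X)} {Γ : Ambient X → X →L[ℝ] EndGen X}
    {x : Ambient X → X} (hΓ : ContDiffOn ℝ ∞ Γ O) (hx : ContDiffOn ℝ ∞ x O) :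
    ContDiffOn ℝ ∞ (fun b => horLift (Γ b) b.2 (x b)) O := by
  have h1 : ContDiffOn ℝ ∞ (fun b => Γ b (x b)) O := hΓ.clm_apply hx
  have h2 : ContDiffOn ℝ ∞ (fun b : Ambient X => b.2) O := contDiff_snd.contDiffOn
  have h : ContDiffOn ℝ ∞ (fun b => (x b, -((Γ b (x b)).comp b.2 - b.2.comp (Γ b (x b))))) O :=
    hx.prodMk ((h1.clm_comp h2).sub (h2.clm_comp h1)).neg
  exact h.congr fun b _ => horLift_apply _ _ _

end Fields

/-! ### The base component of the Nijenhuis tensor. -/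

section Nijenhuis

variable {X : Type*} [NormedAddCommGroup X] [NormedSpace ℝ X]

theorem genEq_of_eq {W : Type*} [NormedAddCommGroup W] [NormedSpace ℝ W] {S : Set W} {a : W}
    {𝔸 𝔹 : GenVec W} (h : 𝔸 = 𝔹) : GenEq S a 𝔸 𝔹 :=
  h ▸ ⟨rfl, fun _ _ => rfl⟩

theorem genStructure_horizontal (Γ : X →L[ℝ] EndGen X) (p : EndGen X) (ε : Index) (K : EndGen X)
    (A : GenVec X) :
    genStructure Γ p ε K
        (horLift Γ K A.1, A.2.comp (ContinuousLinearMap.fst ℝ X (EndGen X))) =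
      (horLift Γ K (K A).1, (K A).2.comp (ContinuousLinearMap.fst ℝ X (EndGen X))) := by
  have h1 : (A.2.comp (ContinuousLinearMap.fst ℝ X (EndGen X))).comp (horLift Γ K) = A.2 := by
    ext v; simp [horLift_apply]
  have h2 : verProj Γ K (horLift Γ K A.1) = 0 := by
    rw [verProj_apply, horLift_apply]; simp
  have h3 : (A.2.comp (ContinuousLinearMap.fst ℝ X (EndGen X))).comp
      (ContinuousLinearMap.inr ℝ X (EndGen X)) = 0 := by
    ext v; simp
  have h4 : (horLift Γ K A.1).1 = A.1 := by rw [horLift_apply]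
  simp only [genStructure, h1, h2, h3, h4, map_zero, ContinuousLinearMap.zero_comp, sub_zero,
    Prod.mk_zero_zero, add_zero]

theorem genStructure_vertical (Γ : X →L[ℝ] EndGen X) (p : EndGen X) (ε : Index)
    (K V : EndGen X) :
    genStructure Γ p ε K (((0, V), 0) : GenVec (Ambient X)) =
      ((0, fibreStructure p ε K V), 0) := by
  have h1 : verProj Γ K ((0, V) : Ambient X) = V := by
    rw [verProj_apply]; simp
  have h2 : K (((0 : X), (0 : X →L[ℝ] ℝ)) : GenVec X) = 0 := map_zero K
  simp only [genStructure, h1, ContinuousLinearMap.zero_comp, sub_zero, h2, Prod.fst_zero,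
    Prod.snd_zero, map_zero, zero_add]

/-- Only the base vector and the horizontal restriction of the form enter here, so
`courant_vertical` supplies everything needed from the brackets. -/
theorem genStructure_fst_fst (Γ : X →L[ℝ] EndGen X) (p : EndGen X) (ε : Index) (K : EndGen X)
    (𝔸 : GenVec (Ambient X)) :
    (genStructure Γ p ε K 𝔸).1.1 = (K (𝔸.1.1, 𝔸.2.comp (horLift Γ K))).1 := by
  simp [genStructure, horLift_apply]

/-- The base component of `N(A₀^h, V)` has four terms: the two brackets with the constant `A₀`
contribute `0`, the bracket `[𝒦A, 𝒦B]` contributes the vector part of `-(𝒫_ε V) A₀`, and `-𝒦[𝒦A, B]`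
that of `K V A₀`. -/
theorem fibreStructure_eq_of_isIntegrable [FiniteDimensional ℝ X] {U : Set X} (hU : IsOpen U)
    {P : X → EndGen X} {Γ : X → X →L[ℝ] EndGen X} (hP : ContDiffOn ℝ ∞ P U)
    (hΓ : ContDiffOn ℝ ∞ Γ U)
    (hPP : ∀ y ∈ U, P y * P y = P y) (hPs : ∀ y ∈ U, IsSymm (P y))
    (hpar : ∀ y ∈ U, ∀ v, fderiv ℝ P y v = P y * Γ y v - Γ y v * P y)
    (hΓs : ∀ y ∈ U, ∀ v, IsSkew (Γ y v)) {ε : Index}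
    (hint : IsIntegrable (adaptedSet U P) fun b => genStructure (Γ b.1) (P b.1) ε b.2)
    {a : Ambient X} (ha : a ∈ adaptedSet U P) {V₀ : EndGen X} (hVs : IsSkew V₀)
    (hVa : V₀ * a.2 + a.2 * V₀ = 0) (hVc : Commute V₀ (P a.1)) (A₀ : GenVec X) :
    (fibreStructure (P a.1) ε a.2 V₀ A₀).1 = (a.2 (V₀ A₀)).1 := by
  set O : Set (Ambient X) := U ×ˢ Set.univ with hO
  have hOo : IsOpen O := hU.prod isOpen_univ
  have hPd : ∀ y ∈ U, DifferentiableAt ℝ P y := fun y hy =>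
    (hP.contDiffAt (hU.mem_nhds hy)).differentiableAt (by simp)
  have hP1 : ContDiffOn ℝ ∞ (fun b : Ambient X => P b.1) O :=
    hP.comp contDiff_fst.contDiffOn fun b hb => hb.1
  have hΓ1 : ContDiffOn ℝ ∞ (fun b : Ambient X => Γ b.1) O :=
    hΓ.comp contDiff_fst.contDiffOn fun b hb => hb.1
  have hK : ContDiffOn ℝ ∞ (fun b : Ambient X => b.2 A₀) O :=
    contDiff_snd.contDiffOn.clm_apply contDiffOn_const
  have hV := contDiffOn_verticalField hP V₀
  have hW := contDiffOn_fibreStructure hP1 hV ε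
  have hA := contDiffOn_horLift hΓ1 (contDiffOn_const (c := A₀.1))
  have hKA := contDiffOn_horLift hΓ1 (contDiff_fst.comp_contDiffOn hK)
  set θ : Ambient X → X →L[ℝ] ℝ := fun b => (b.2 A₀).2 with hθ
  have hθc : ContDiffOn ℝ ∞ θ O := contDiff_snd.comp_contDiffOn hK
  have haO : a ∈ O := ⟨ha.1, Set.mem_univ _⟩
  have hnhds : O ∈ 𝓝 a := hOo.mem_nhds haO
  set A : Ambient X → GenVec (Ambient X) := fun b =>
    (horLift (Γ b.1) b.2 A₀.1, A₀.2.comp (ContinuousLinearMap.fst ℝ X (EndGen X))) with hAdef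
  set KA : Ambient X → GenVec (Ambient X) := fun b =>
    (horLift (Γ b.1) b.2 (b.2 A₀).1, (θ b).comp (ContinuousLinearMap.fst ℝ X (EndGen X)))
    with hKAdef
  set B : Ambient X → GenVec (Ambient X) := fun b => ((0, verticalField P V₀ b), 0) with hBdef
  set KB : Ambient X → GenVec (Ambient X) := fun b =>
    ((0, fibreStructure (P b.1) ε b.2 (verticalField P V₀ b)), 0) with hKBdef
  have key := hint O hOo A B KA KB
    ⟨hA.prodMk contDiffOn_const, fun b hb =>
      horLift_mem_tangentSet hU hPd hPP hPs hb.1 (hpar _ hb.1.1) (hΓs _ hb.1.1) _⟩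
    ⟨(contDiffOn_const.prodMk hV).prodMk contDiffOn_const, fun b hb =>
      vertical_mem_tangentSet hU hPd hPP hPs hb.1
        (isSkew_verticalField (hPs _ hb.1.1) hb.1.2.2.1 hVs)
        (verticalField_anticommute hb.1.2.1)
        (commute_verticalField (hPP _ hb.1.1) hb.1.2.2.2)⟩
    (hKA.prodMk (hθc.clm_comp contDiffOn_const))
    ((contDiffOn_const.prodMk hW).prodMk contDiffOn_const)
    (fun b _ => genEq_of_eq (genStructure_horizontal (Γ b.1) (P b.1) ε b.2 A₀).symm)
    (fun b _ => genEq_of_eq (genStructure_vertical (Γ b.1) (P b.1) ε b.2 _).symm)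
    a ⟨ha, haO⟩
  have hfst := congrArg Prod.fst key.1
  have hVa0 : verticalField P V₀ a = V₀ := verticalField_eq (hPP _ ha.1) ha.2.1 hVa hVc
  have hVd := (hV.contDiffAt hnhds).differentiableAt (by simp)
  have hWd := (hW.contDiffAt hnhds).differentiableAt (by simp)
  have hAd : DifferentiableAt ℝ (fun b : Ambient X => (horLift (Γ b.1) b.2 A₀.1).2) a :=
    ((hA.contDiffAt hnhds).differentiableAt (by simp)).snd
  have hKAd : DifferentiableAt ℝ (fun b : Ambient X => (horLift (Γ b.1) b.2 (b.2 A₀).1).2) a :=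
    ((hKA.contDiffAt hnhds).differentiableAt (by simp)).snd
  have hEv : HasFDerivAt (fun b : Ambient X => b.2 A₀)
      ((ContinuousLinearMap.apply ℝ (GenVec X) A₀).comp
        (ContinuousLinearMap.snd ℝ X (EndGen X))) a :=
    ((ContinuousLinearMap.apply ℝ (GenVec X) A₀).comp
        (ContinuousLinearMap.snd ℝ X (EndGen X))).hasFDerivAt
  have hA' : A = fun b => ((A₀.1, (horLift (Γ b.1) b.2 A₀.1).2),
      A₀.2.comp (ContinuousLinearMap.fst ℝ X (EndGen X))) := by
    funext b; simp only [hAdef, horLift_apply]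
  have hKA' : KA = fun b => (((b.2 A₀).1, (horLift (Γ b.1) b.2 (b.2 A₀).1).2),
      (θ b).comp (ContinuousLinearMap.fst ℝ X (EndGen X))) := by
    funext b; simp only [hKAdef, horLift_apply]
  have c1 := courant_vertical (hasFDerivAt_const A₀.1 a) hAd (hasFDerivAt_const A₀.2 a) hVd
  have c2 := courant_vertical (hasFDerivAt_const A₀.1 a) hAd (hasFDerivAt_const A₀.2 a) hWd
  have c3 := courant_vertical hEv.fst hKAd hEv.snd hVd
  have c4 := courant_vertical hEv.fst hKAd hEv.snd hWd
  rw [← hA'] at c1 c2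
  rw [← hKA'] at c3 c4
  have hfst' : (courant A B a).1.1 + (courant KA KB a).1.1 -
      (genStructure (Γ a.1) (P a.1) ε a.2 (courant KA B a)).1.1 -
      (genStructure (Γ a.1) (P a.1) ε a.2 (courant A KB a)).1.1 = 0 := hfst
  rw [genStructure_fst_fst, genStructure_fst_fst, c1.1, c2.1, c2.2, c3.1, c3.2, c4.1, hVa0]
    at hfst'
  -- The horizontal part of the form in `[𝒦A, B]` is `-(V A₀).2`; together with the base vector `-(V
  -- A₀).1` it makes up `-V A₀`, to which `K` is then applied.
  have e1 : (-((((ContinuousLinearMap.snd ℝ X (X →L[ℝ] ℝ)).comp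
      ((ContinuousLinearMap.apply ℝ (GenVec X) A₀).comp
        (ContinuousLinearMap.snd ℝ X (EndGen X)))) (0, V₀)).comp
          (ContinuousLinearMap.fst ℝ X (EndGen X)))).comp (horLift (Γ a.1) a.2) = -(V₀ A₀).2 := by
    ext v
    simp [horLift_apply]
  have e2 : (-(((0 : Ambient X →L[ℝ] X →L[ℝ] ℝ)
      (0, fibreStructure (P a.1) ε a.2 V₀)).comp
          (ContinuousLinearMap.fst ℝ X (EndGen X)))).comp (horLift (Γ a.1) a.2) = 0 := by
    ext v
    simp
  rw [e1, e2] at hfst'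
  have e3 : a.2 (((-(0 : X)), (0 : X →L[ℝ] ℝ)) : GenVec X) = 0 := by
    rw [neg_zero]; exact map_zero a.2
  have e4 : a.2 ((-(V₀ A₀).1, -(V₀ A₀).2) : GenVec X) = -a.2 (V₀ A₀) := map_neg a.2 (V₀ A₀)
  have hfst2 : -(0 : X) + -(fibreStructure (P a.1) ε a.2 V₀ A₀).1 -
      (a.2 ((-(V₀ A₀).1, -(V₀ A₀).2) : GenVec X)).1 -
      (a.2 (((-(0 : X)), (0 : X →L[ℝ] ℝ)) : GenVec X)).1 = 0 := hfst'
  rw [e3, e4, neg_zero, zero_add, Prod.fst_neg, Prod.fst_zero, sub_zero, sub_neg_eq_add] at hfst2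
  exact (neg_add_eq_zero.1 hfst2)

end Nijenhuis

/-! ### Endomorphisms that permute and rescale a frame. -/

section Frames

variable {X : Type*} [NormedAddCommGroup X] [NormedSpace ℝ X] {J : Type*}

theorem ext_basis {f : Module.Basis J ℝ (GenVec X)} {K L : EndGen X}
    (h : ∀ j, K (f j) = L (f j)) : K = L :=
  ContinuousLinearMap.coe_injective (f.ext h)

variable [FiniteDimensional ℝ X]

/-- The endomorphism `f j ↦ τ j • f (κ j)`. -/
def monomialEnd (f : Module.Basis J ℝ (GenVec X)) (κ : J → J) (τ : J → ℝ) : EndGen X :=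
  LinearMap.toContinuousLinearMap (f.constr ℝ fun j => τ j • f (κ j))

theorem monomialEnd_apply (f : Module.Basis J ℝ (GenVec X)) (κ : J → J) (τ : J → ℝ) (j : J) :
    monomialEnd f κ τ (f j) = τ j • f (κ j) := by
  simp [monomialEnd, Module.Basis.constr_basis]

/-- In an orthogonal frame with `κ` an involution, skewness has content only on the pairs `(j, κ
j)`, which is the sign condition `h`. -/
theorem isSkew_monomialEnd [DecidableEq J] {f : Module.Basis J ℝ (GenVec X)} {κ : J → J}
    {τ σ : J → ℝ} (hf : ∀ i j, pairing (f i) (f j) = if i = j then σ i else 0)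
    (hκ : ∀ j, κ (κ j) = j) (h : ∀ j, τ j * σ (κ j) + τ (κ j) * σ j = 0) :
    IsSkew (monomialEnd f κ τ) := by
  set K := monomialEnd f κ τ with hK
  have h1 : (pairing (T := X)).comp (K : GenVec X →ₗ[ℝ] GenVec X) LinearMap.id +
      (pairing (T := X)).comp LinearMap.id (K : GenVec X →ₗ[ℝ] GenVec X) = 0 := by
    refine LinearMap.BilinForm.ext_basis f fun i j => ?_
    change pairing (K (f i)) (f j) + pairing (f i) (K (f j)) = 0
    rw [hK, monomialEnd_apply, monomialEnd_apply, map_smul, map_smul, LinearMap.smul_apply, hf, hf]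
    by_cases hij : κ i = j
    · subst hij
      simp only [hκ, if_true, smul_eq_mul]
      exact h i
    · have : i ≠ κ j := fun hh => hij (by rw [hh, hκ])
      simp [hij, this]
  intro A B
  exact LinearMap.congr_fun (LinearMap.congr_fun h1 A) B

theorem commute_monomialEnd {f : Module.Basis J ℝ (GenVec X)} {κ : J → J} {τ : J → ℝ}
    {p : EndGen X} {χ : J → ℝ} (hp : ∀ j, p (f j) = χ j • f j) (h : ∀ j, χ (κ j) = χ j) :
    Commute (monomialEnd f κ τ) p := by
  refine ext_basis (f := f) fun j => ?_
  simp only [mul_apply_eq_comp, hp, monomialEnd_apply, map_smul, h]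
  rw [smul_comm]

end Frames

/-! ### Adapted orthonormal frames and an explicit vertical vector. -/

section Existence

variable {X : Type*} [NormedAddCommGroup X] [NormedSpace ℝ X] [FiniteDimensional ℝ X]

theorem finrank_genVec : Module.finrank ℝ (GenVec X) = 2 * Module.finrank ℝ X := by
  rw [Module.finrank_prod, ← (LinearMap.toContinuousLinearMap (E := X) (F' := ℝ)).finrank_eq,
    Module.finrank_linearMap_self, two_mul]

/-- A generalized metric and its orthogonal complement have orthonormal frames with the same
vector parts. -/
theorem IsGenMetric.exists_basis {n : ℕ} {E : Submodule ℝ (GenVec X)} (hE : IsGenMetric n E) :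
    ∃ f : Module.Basis ((Fin n ⊕ Fin n) ⊕ (Fin n ⊕ Fin n)) ℝ (GenVec X),
      (∀ i j, pairing (f i) (f j) = if i = j then
        Sum.elim (Sum.elim (fun _ => (1 : ℝ)) (fun _ => -1))
          (Sum.elim (fun _ => (-1 : ℝ)) (fun _ => 1)) i else 0) ∧
      (∀ i, f (Sum.inl i) ∈ E) ∧ (∀ i, f (Sum.inr i) ∈ perp E) ∧
      (∀ i, (f (Sum.inl i)).1 ≠ 0) ∧ ∀ i, (f (Sum.inr i)).1 ≠ 0 := by
  obtain ⟨b, hb⟩ := hE.signature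
  have hcard : Fintype.card (Fin n ⊕ Fin n) = Module.finrank ℝ X := by
    rw [← hE.finrank_eq, Module.finrank_eq_card_basis b]
  have hli : LinearIndependent ℝ fun i => (b i : GenVec X).1 := by
    have h1 := b.linearIndependent.map' ((LinearMap.fst ℝ X (X →L[ℝ] ℝ)).comp E.subtype) (by
      rw [LinearMap.ker_eq_bot']
      intro A hA
      exact Subtype.ext (hE.inter_dual A A.2 hA))
    exact h1
  -- As `E ∩ T* = 0` and `dim E = dim T`, the vector parts of a basis of `E` form a basis of `T`.
  set bT : Module.Basis (Fin n ⊕ Fin n) ℝ X := basisOfLinearIndependentOfCardEqFinrank' _ hli hcard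
    with hbT
  have hbTi : ∀ i, bT i = (b i : GenVec X).1 := fun i => by
    rw [hbT, coe_basisOfLinearIndependentOfCardEqFinrank']
  set s : Fin n ⊕ Fin n → ℝ := Sum.elim (fun _ => (1 : ℝ)) (fun _ => -1) with hs
  have hs0 : ∀ i, s i ≠ 0 := by rintro (i | i) <;> simp [hs]
  -- If `E` is the graph of `X ↦ g(X) + B(X)` with `g` symmetric and `B` skew, then `E^⊥` is the
  -- graph of `-g + B`. Subtracting `2 g(b i)`, which is `2 s i` times a dual basis covector, gives
  -- the vector of `E^⊥` with the same vector part and the opposite norm.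
  set c : Fin n ⊕ Fin n → GenVec X := fun i =>
    (b i : GenVec X) - ((0 : X), (2 * s i) • LinearMap.toContinuousLinearMap (bT.coord i)) with hc
  have hα : ∀ (i : Fin n ⊕ Fin n) (A : GenVec X),
      pairing A ((0 : X), (2 * s i) • LinearMap.toContinuousLinearMap (bT.coord i)) =
        s i * bT.repr A.1 i := by
    intro i A
    change (1 / 2 : ℝ) * (A.2 0 + (2 * s i) * bT.repr A.1 i) = _
    rw [map_zero]; ring
  have hpc : ∀ A B : GenVec X, pairing A B = pairing B A := fun A B => by
    change (1 / 2 : ℝ) * (A.2 B.1 + B.2 A.1) = (1 / 2 : ℝ) * (B.2 A.1 + A.2 B.1)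
    ring
  have hrepr : ∀ i j, bT.repr (b i : GenVec X).1 j = if i = j then 1 else 0 := fun i j => by
    rw [← hbTi, bT.repr_self, Finsupp.single_apply]
  have hbc : ∀ i j, pairing (b i : GenVec X) (c j) = 0 := by
    intro i j
    rw [hc]
    dsimp only
    rw [map_sub, hα, hb, hrepr]
    by_cases h : i = j
    · subst h; simp [hs]
    · simp [h]
  have hcc : ∀ i j, pairing (c i) (c j) = if i = j then -s i else 0 := by
    intro i j
    have h1 : pairing (c i) (c j) = pairing (b i : GenVec X) (c j) - pairing
        (((0 : X), (2 * s i) • LinearMap.toContinuousLinearMap (bT.coord i)) : GenVec X) (c j) :=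
      LinearMap.map_sub₂ pairing _ _ (c j)
    have h2 : (c j).1 = (b j : GenVec X).1 := by simp [hc]
    rw [h1, hbc, hpc, hα, h2, hrepr]
    by_cases h : i = j
    · subst h; simp
    · simp [h, Ne.symm h]
  set f : (Fin n ⊕ Fin n) ⊕ (Fin n ⊕ Fin n) → GenVec X := Sum.elim (fun i => b i) c with hf
  have hff : ∀ i j, pairing (f i) (f j) = if i = j then Sum.elim s (fun i => -s i) i else 0 := by
    rintro (i | i) (j | j)
    · simp only [hf, Sum.elim_inl, Sum.inl.injEq]; exact hb i j
    · simp only [hf, Sum.elim_inl, Sum.elim_inr, reduceCtorEq, if_false]; exact hbc i j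
    · simp only [hf, Sum.elim_inl, Sum.elim_inr, reduceCtorEq, if_false]; rw [hpc]; exact hbc j i
    · simp only [hf, Sum.elim_inr, Sum.inr.injEq]; exact hcc i j
  have hfli : LinearIndependent ℝ f := by
    refine LinearMap.BilinForm.linearIndependent_of_iIsOrtho (B := pairing) (v := f) ?_ ?_
    · intro i j hij
      change pairing (f i) (f j) = 0
      rw [hff, if_neg hij]
    · intro i hi
      have hi' : pairing (f i) (f i) = 0 := hi
      rw [hff, if_pos rfl] at hi'
      rcases i with i | i
      · exact hs0 i hi'
      · exact hs0 i (neg_eq_zero.1 hi')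
  have hfcard : Fintype.card ((Fin n ⊕ Fin n) ⊕ (Fin n ⊕ Fin n)) =
      Module.finrank ℝ (GenVec X) := by
    rw [finrank_genVec, Fintype.card_sum, hcard, two_mul]
  refine ⟨basisOfLinearIndependentOfCardEqFinrank' _ hfli hfcard, ?_, ?_, ?_, ?_, ?_⟩ <;>
    rw [coe_basisOfLinearIndependentOfCardEqFinrank']
  · intro i j
    rw [hff]
    congr 1
    rcases i with (i | i) | (i | i) <;> simp [hs]
  · intro i
    exact (b i).2
  · intro i A hA
    change pairing A (c i) = 0
    have h2 : A = ∑ j, b.repr ⟨A, hA⟩ j • (b j : GenVec X) := by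
      calc A = ((⟨A, hA⟩ : E) : GenVec X) := rfl
        _ = ((∑ j, b.repr ⟨A, hA⟩ j • b j : E) : GenVec X) := by rw [b.sum_repr]
        _ = _ := by rw [Submodule.coe_sum]; rfl
    rw [h2, map_sum, LinearMap.sum_apply]
    exact Finset.sum_eq_zero fun j _ => by rw [map_smul, LinearMap.smul_apply, hbc, smul_zero]
  · intro i
    exact hli.ne_zero i
  · intro i
    change (c i).1 ≠ 0
    have h2 : (c i).1 = (b i : GenVec X).1 := by simp [hc]
    rw [h2]
    exact hli.ne_zero i

/-- The generic fibre of the reflector space contains a point `K` with a vertical vector `V` such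
that `K V` does not vanish on `E'`, nor on `E''`. -/
theorem IsGenMetric.exists_vertical {n : ℕ} (hn : 2 ≤ n) {E : Submodule ℝ (GenVec X)}
    (hE : IsGenMetric n E) {p : EndGen X} (hp : ∀ A ∈ E, p A = A) (hp' : ∀ A ∈ perp E, p A = 0) :
    ∃ K V : EndGen X, K * K = 1 ∧ IsSkew K ∧ Commute K p ∧ IsSkew V ∧ V * K + K * V = 0 ∧
      Commute V p ∧ (∃ A ∈ E, (K (V A)).1 ≠ 0) ∧ ∃ A ∈ perp E, (K (V A)).1 ≠ 0 := by
  obtain ⟨f, hff, hfE, hfP, hf1, hf2⟩ := hE.exists_basis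
  set z : Fin n := ⟨0, by omega⟩ with hz
  set o : Fin n := ⟨1, by omega⟩ with ho
  have hzo : z ≠ o := by simp [hz, ho]
  -- The plan: `K` exchanges, in each of `E` and `E^⊥`, the `i`-th positive and negative frame
  -- vectors. `V` is a quarter turn in the plane of the indices `z`, `o` on one half of each block,
  -- its negative on the other half, and zero on the remaining vectors. The opposite signs on the
  -- two halves make `V` anticommute with `K`.
  set w : Fin n → Fin n := fun i => Equiv.swap z o i with hw
  have hww : ∀ i, w (w i) = i := Equiv.swap_apply_self z o
  set u : Fin n → ℝ := fun i => if i = z then 1 else if i = o then -1 else 0 with hu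
  have huw : ∀ i, u (w i) = -u i := by
    intro i
    by_cases h1 : i = z
    · subst h1; simp [hw, hu, hzo.symm]
    · by_cases h2 : i = o
      · subst h2; simp [hw, hu, hzo.symm]
      · simp [hw, hu, h1, h2, Equiv.swap_apply_of_ne_of_ne h1 h2]
  set κ : (Fin n ⊕ Fin n) ⊕ (Fin n ⊕ Fin n) → (Fin n ⊕ Fin n) ⊕ (Fin n ⊕ Fin n) :=
    Sum.map Sum.swap Sum.swap with hκ
  set v : (Fin n ⊕ Fin n) ⊕ (Fin n ⊕ Fin n) → (Fin n ⊕ Fin n) ⊕ (Fin n ⊕ Fin n) :=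
    Sum.map (Sum.map w w) (Sum.map w w) with hv
  set τ : (Fin n ⊕ Fin n) ⊕ (Fin n ⊕ Fin n) → ℝ :=
    Sum.elim (Sum.elim u fun i => -u i) (Sum.elim u fun i => -u i) with hτ
  -- The eigenvalues of `p` on the frame.
  set χ : (Fin n ⊕ Fin n) ⊕ (Fin n ⊕ Fin n) → ℝ := Sum.elim (fun _ => 1) (fun _ => 0) with hχ
  have hpf : ∀ j, p (f j) = χ j • f j := by
    rintro (j | j)
    · rw [hp _ (hfE j)]; simp [hχ]
    · rw [hp' _ (hfP j)]; simp [hχ]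
  have hKV : ∀ j, monomialEnd f κ (fun _ => 1) (monomialEnd f v τ (f j)) = τ j • f (κ (v j)) := by
    intro j
    rw [monomialEnd_apply, map_smul, monomialEnd_apply, one_smul]
  refine ⟨monomialEnd f κ fun _ => 1, monomialEnd f v τ, ?_, ?_, ?_, ?_, ?_, ?_, ?_, ?_⟩
  · refine ext_basis (f := f) fun j => ?_
    rw [mul_apply_eq_comp, monomialEnd_apply, one_smul, monomialEnd_apply, one_smul]
    rcases j with (j | j) | (j | j) <;> rfl
  · refine isSkew_monomialEnd hff ?_ ?_
    · rintro ((j | j) | (j | j)) <;> rfl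
    · rintro ((j | j) | (j | j)) <;> simp [hκ]
  · refine commute_monomialEnd hpf ?_
    rintro ((j | j) | (j | j)) <;> rfl
  · refine isSkew_monomialEnd hff ?_ ?_
    · rintro ((j | j) | (j | j)) <;> simp [hv, hww]
    · rintro ((j | j) | (j | j)) <;> simp [hv, hτ, huw]
  · refine ext_basis (f := f) fun j => ?_
    rw [add_apply, mul_apply_eq_comp, mul_apply_eq_comp, hKV, monomialEnd_apply, one_smul,
      monomialEnd_apply]
    rcases j with (j | j) | (j | j) <;> simp [hκ, hv, hτ]
  · refine commute_monomialEnd hpf ?_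
    rintro ((j | j) | (j | j)) <;> rfl
  -- `K V` sends this frame vector to another frame vector of `E`, whose vector part is nonzero; the
  -- same works in `E^⊥`.
  · refine ⟨f (Sum.inl (Sum.inl z)), hfE _, ?_⟩
    rw [hKV]
    have h1 : τ (Sum.inl (Sum.inl z)) = 1 := by simp [hτ, hu]
    rw [h1, one_smul]
    exact hf1 _
  · refine ⟨f (Sum.inr (Sum.inl z)), hfP _, ?_⟩
    rw [hKV]
    have h1 : τ (Sum.inr (Sum.inl z)) = 1 := by simp [hτ, hu]
    rw [h1, one_smul]
    exact hf2 _

end Existence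

/-! ### Orthogonal projections for the neutral metric. -/

section OrthogonalProjection

variable {X : Type*} [NormedAddCommGroup X] [NormedSpace ℝ X]

theorem pairing_comm (A B : GenVec X) : pairing A B = pairing B A := by
  change (1 / 2 : ℝ) * (A.2 B.1 + B.2 A.1) = (1 / 2 : ℝ) * (B.2 A.1 + A.2 B.1)
  ring

theorem pairing_left_injective [FiniteDimensional ℝ X] {A : GenVec X}
    (h : ∀ B, pairing A B = 0) : A = 0 := by
  have h1 : ∀ B : GenVec X, A.2 B.1 + B.2 A.1 = 0 := fun B => by
    have h2 : (1 / 2 : ℝ) * (A.2 B.1 + B.2 A.1) = 0 := h B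
    linarith
  refine Prod.ext ?_ ?_
  · by_contra hne
    obtain ⟨g, hg⟩ := SeparatingDual.exists_ne_zero (R := ℝ) hne
    have := h1 (0, g)
    simp only [map_zero, zero_add] at this
    exact hg this
  · ext v
    simpa using h1 (v, 0)

/-- `p` is the orthogonal projection onto `E`. -/
structure IsOrthProj (E : Submodule ℝ (GenVec X)) (p : EndGen X) : Prop where
  mem : ∀ w, p w ∈ E
  sub_mem : ∀ w, w - p w ∈ perp E
  disjoint : Disjoint E (perp E)

namespace IsOrthProj

variable {E : Submodule ℝ (GenVec X)} {p : EndGen X}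

theorem apply_of_mem (h : IsOrthProj E p) {w : GenVec X} (hw : w ∈ E) : p w = w :=
  (sub_eq_zero.1 ((Submodule.disjoint_def.1 h.disjoint) _ (E.sub_mem hw (h.mem w))
    (h.sub_mem w))).symm

theorem apply_of_mem_perp (h : IsOrthProj E p) {w : GenVec X} (hw : w ∈ perp E) : p w = 0 := by
  refine (Submodule.disjoint_def.1 h.disjoint) _ (h.mem w) ?_
  have := (perp E).sub_mem hw (h.sub_mem w)
  rwa [sub_sub_cancel] at this

theorem mul_self (h : IsOrthProj E p) : p * p = p :=
  ContinuousLinearMap.ext fun w => h.apply_of_mem (h.mem w)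

theorem pairing_eq_zero {A B : GenVec X} (hA : A ∈ E) (hB : B ∈ perp E) : pairing A B = 0 :=
  hB A hA

theorem isSymm (h : IsOrthProj E p) : IsSymm p := by
  intro A B
  have h1 := pairing_eq_zero (h.mem A) (h.sub_mem B)
  have h2 := pairing_eq_zero (h.mem B) (h.sub_mem A)
  rw [map_sub] at h1 h2
  rw [pairing_comm A (p B), sub_eq_zero.1 h1, sub_eq_zero.1 h2, pairing_comm]

theorem ext {q : EndGen X} (h : IsOrthProj E p) (hq : ∀ w ∈ E, q w = w)
    (hq' : ∀ w ∈ perp E, q w = 0) : q = p := by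
  refine ContinuousLinearMap.ext fun w => ?_
  calc q w = q (p w + (w - p w)) := by rw [add_sub_cancel]
    _ = p w := by rw [map_add, hq _ (h.mem w), hq' _ (h.sub_mem w), add_zero]

/-- A skew map preserving `E` also preserves `E^⊥`, so invariance of `E` alone amounts to commuting
with the projection. -/
theorem commute_iff (h : IsOrthProj E p) {K : EndGen X} (hK : IsSkew K) :
    Commute K p ↔ ∀ A ∈ E, K A ∈ E := by
  constructor
  · intro hc A hA
    have h1 : K (p A) = p (K A) := DFunLike.congr_fun hc A
    rw [h.apply_of_mem hA] at h1
    rw [h1]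
    exact h.mem _
  · intro hE
    refine ContinuousLinearMap.ext fun w => ?_
    change K (p w) = p (K w)
    have h1 : K (w - p w) ∈ perp E := by
      intro A hA
      change pairing A (K (w - p w)) = 0
      have h2 := hK A (w - p w)
      rwa [pairing_eq_zero (hE A hA) (h.sub_mem w), zero_add] at h2
    have h3 := h.apply_of_mem_perp h1
    rw [map_sub, map_sub, h.apply_of_mem (hE _ (h.mem w))] at h3
    exact (sub_eq_zero.1 h3).symm

end IsOrthProj

/-- A nonzero multiple of the identity is symmetric for a nondegenerate form, hence not skew. So `K
≠ ± Id` is automatic in the fibre. -/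
theorem ne_id_of_isSkew [FiniteDimensional ℝ X] [Nontrivial X] {K : EndGen X} (hK : IsSkew K)
    {c : ℝ} (hc : c ≠ 0) : (K : GenVec X →ₗ[ℝ] GenVec X) ≠ c • LinearMap.id := by
  intro h
  have hK' : ∀ A, K A = c • A := fun A => LinearMap.congr_fun h A
  obtain ⟨x, hx⟩ := exists_ne (0 : X)
  have h0 : ((x, 0) : GenVec X) = 0 := by
    refine pairing_left_injective fun B => ?_
    have := hK (x, 0) B
    rw [hK', hK', map_smul, map_smul, LinearMap.smul_apply, smul_eq_mul, ← mul_add] at this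
    rcases mul_eq_zero.1 this with h | h
    · exact absurd h hc
    · linarith
  exact hx (congrArg Prod.fst h0)

end OrthogonalProjection

/-! ### Smooth dependence of the projection on a frame. -/

section SmoothProjection

variable {X : Type*} [NormedAddCommGroup X] [NormedSpace ℝ X]
  {ι : Type*} [Fintype ι]

/-- The linear combinations of a family of vectors. -/
def combL (σ : ι → GenVec X) : (ι → ℝ) →L[ℝ] GenVec X :=
  ∑ i, (ContinuousLinearMap.proj (R := ℝ) (φ := fun _ : ι => ℝ) i).smulRight (σ i)

theorem combL_apply (σ : ι → GenVec X) (c : ι → ℝ) : combL σ c = ∑ i, c i • σ i := by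
  simp [combL]

/-- The pairings with a family of vectors. -/
def pairL [DecidableEq ι] (σ : ι → GenVec X) : GenVec X →L[ℝ] ι → ℝ :=
  ∑ i, (pairingL (σ i)).smulRight (Pi.single i (1 : ℝ))

theorem pairL_apply [DecidableEq ι] (σ : ι → GenVec X) (w : GenVec X) (i : ι) :
    pairL σ w i = pairing (σ i) w := by
  simp only [pairL, sum_apply, ContinuousLinearMap.smulRight_apply, Finset.sum_apply,
    Pi.smul_apply, Pi.single_apply, smul_eq_mul, mul_ite, mul_one, mul_zero, Finset.sum_ite_eq,
    Finset.mem_univ, if_true]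
  rfl

/-- The Gram formula `p = S G⁻¹ T` for the projection onto the span of `σ`, with `S` forming
combinations, `T` pairing with `σ`, and `G = T S` the Gram map. `G` is injective since its kernel
gives elements of `E ∩ E^⊥ = 0`. -/
theorem exists_equiv_pairL_comp_combL [DecidableEq ι] {σ : ι → GenVec X}
    {E : Submodule ℝ (GenVec X)} {p : EndGen X}
    (hE : E = Submodule.span ℝ (Set.range σ)) (hp : IsOrthProj E p)
    (hrank : Module.finrank ℝ E = Fintype.card ι) :
    ∃ G : (ι → ℝ) ≃L[ℝ] (ι → ℝ), (G : (ι → ℝ) →L[ℝ] ι → ℝ) = (pairL σ).comp (combL σ) ∧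
      p = ((combL σ).comp (G.symm : (ι → ℝ) →L[ℝ] ι → ℝ)).comp (pairL σ) := by
  have hli : LinearIndependent ℝ σ := by
    rw [linearIndependent_iff_card_eq_finrank_span, Set.finrank, ← hE, hrank]
  have hmem : ∀ c, combL σ c ∈ E := fun c => by
    rw [combL_apply, hE]
    exact Submodule.sum_mem _ fun i _ => Submodule.smul_mem _ _
      (Submodule.subset_span (Set.mem_range_self i))
  have hperp : ∀ w, pairL σ w = 0 → w ∈ perp E := by
    intro w hw A hA
    change pairing A w = 0
    rw [hE] at hA
    induction hA using Submodule.span_induction with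
    | mem A hA =>
      obtain ⟨i, rfl⟩ := hA
      rw [← pairL_apply, hw]; rfl
    | zero => rw [map_zero]; rfl
    | add A B _ _ hA hB => rw [map_add, LinearMap.add_apply, hA, hB, add_zero]
    | smul c A _ hA => rw [map_smul, LinearMap.smul_apply, hA, smul_zero]
  have hinj : Function.Injective ((pairL σ).comp (combL σ)) := by
    rw [injective_iff_map_eq_zero]
    intro c hc
    have h1 := (Submodule.disjoint_def.1 hp.disjoint) _ (hmem c) (hperp _ hc)
    rw [combL_apply] at h1
    exact funext fun i => Fintype.linearIndependent_iff.1 hli c h1 i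
  set G : (ι → ℝ) ≃L[ℝ] (ι → ℝ) := (LinearEquiv.ofInjectiveEndo
    (((pairL σ).comp (combL σ) : (ι → ℝ) →L[ℝ] ι → ℝ) : (ι → ℝ) →ₗ[ℝ] ι → ℝ)
      hinj).toContinuousLinearEquiv with hG
  have hGa : ∀ c, G c = pairL σ (combL σ c) := fun c => rfl
  refine ⟨G, ContinuousLinearMap.ext hGa, (hp.ext ?_ ?_).symm⟩
  · intro w hw
    have : ∃ c, combL σ c = w := by
      rw [hE, Submodule.mem_span_range_iff_exists_fun] at hw
      obtain ⟨c, hc⟩ := hw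
      exact ⟨c, by rw [combL_apply, hc]⟩
    obtain ⟨c, rfl⟩ := this
    change combL σ (G.symm (pairL σ (combL σ c))) = _
    rw [← hGa, G.symm_apply_apply]
  · intro w hw
    have h1 : pairL σ w = 0 := by
      funext i
      rw [pairL_apply]
      refine hw _ ?_
      rw [hE]
      exact Submodule.subset_span (Set.mem_range_self i)
    change combL σ (G.symm (pairL σ w)) = _
    rw [h1, map_zero, map_zero]

/-- Every factor of the Gram formula depends smoothly on the frame, inversion being smooth at an
invertible map. -/
theorem contDiffAt_orthProj {Y : Type*} [NormedAddCommGroup Y] [NormedSpace ℝ Y]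
    {σ : ι → Y → GenVec X} {y₀ : Y} (hσ : ∀ i, ContDiffAt ℝ ∞ (σ i) y₀)
    {E : Y → Submodule ℝ (GenVec X)} {p : Y → EndGen X}
    (hE : ∀ᶠ y in 𝓝 y₀, E y = Submodule.span ℝ (Set.range fun i => σ i y))
    (hp : ∀ᶠ y in 𝓝 y₀, IsOrthProj (E y) (p y))
    (hrank : ∀ᶠ y in 𝓝 y₀, Module.finrank ℝ (E y) = Fintype.card ι) :
    ContDiffAt ℝ ∞ p y₀ := by
  classical
  have hS : ContDiffAt ℝ ∞ (fun y => combL fun i => σ i y) y₀ := by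
    refine ContDiffAt.sum fun i _ => ?_
    exact (ContinuousLinearMap.smulRightL ℝ (ι → ℝ) (GenVec X)
      (ContinuousLinearMap.proj (R := ℝ) (φ := fun _ : ι => ℝ) i)).contDiff.contDiffAt.comp y₀
        (hσ i)
  have hT : ContDiffAt ℝ ∞ (fun y => pairL fun i => σ i y) y₀ := by
    refine ContDiffAt.sum fun i _ => ?_
    exact ((ContinuousLinearMap.smulRightL ℝ (GenVec X) (ι → ℝ)).flip
      (Pi.single i (1 : ℝ))).contDiff.contDiffAt.comp y₀
        (pairingL.contDiff.contDiffAt.comp y₀ (hσ i))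
  have hG : ContDiffAt ℝ ∞ (fun y => ((pairL fun i => σ i y).comp
      (combL fun i => σ i y)).inverse) y₀ := by
    obtain ⟨G, hG, -⟩ := exists_equiv_pairL_comp_combL hE.self_of_nhds hp.self_of_nhds
      hrank.self_of_nhds
    have h1 := contDiffAt_map_inverse (n := ∞) G
    rw [hG] at h1
    exact h1.comp y₀ (hT.clm_comp hS)
  refine ((hS.clm_comp hG).clm_comp hT).congr_of_eventuallyEq ?_
  filter_upwards [hE, hp, hrank] with y h1 h2 h3
  obtain ⟨G, hG, hpG⟩ := exists_equiv_pairL_comp_combL h1 h2 h3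
  rw [← hG, ContinuousLinearMap.inverse_equiv]
  exact hpG

end SmoothProjection

/-! ### The generalized metric and the reflector space in a chart. -/

section CoordinateProjection

variable {n : ℕ} {M : Type*} [TopologicalSpace M] [ChartedSpace (Model n) M]
  [IsManifold 𝓘(ℝ, Model n) ∞ M]

/-- The coordinate isomorphism `T_xM ⊕ T_x*M ≃ ℝ^{2n} ⊕ (ℝ^{2n})*` of a chart. -/
def genEquiv {x₀ x : M} (h : x ∈ (chartAt (Model n) x₀).source) :
    GenTangent n M x ≃ₗ[ℝ] GenModel n :=
  LinearEquiv.ofLinearMap (genCoord (chartAt (Model n) x₀) x) (genFrame (chartAt (Model n) x₀) x)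
    (LinearMap.ext fun w => genCoord_genFrame h w) (LinearMap.ext fun A => genFrame_genCoord h A)

/-- The subspace `E'` in the coordinates of a chart. -/
def fibCoord (E : GenMetric n M) (e : OpenPartialHomeomorph M (Model n)) (y : Model n) :
    Submodule ℝ (GenModel n) :=
  (E.fib (e.symm y)).map (genCoord e (e.symm y))

variable {E : GenMetric n M} {x₀ : M} {y : Model n}

omit [IsManifold 𝓘(ℝ, Model n) ∞ M] in
theorem symm_mem_source (hy : y ∈ (chartAt (Model n) x₀).target) :
    (chartAt (Model n) x₀).symm y ∈ (chartAt (Model n) x₀).source :=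
  (chartAt (Model n) x₀).map_target hy

theorem mem_fibCoord (hy : y ∈ (chartAt (Model n) x₀).target) {w : GenModel n} :
    w ∈ fibCoord E (chartAt (Model n) x₀) y ↔
      genFrame (chartAt (Model n) x₀) ((chartAt (Model n) x₀).symm y) w ∈
        E.fib ((chartAt (Model n) x₀).symm y) := by
  have hx := symm_mem_source hy
  constructor
  · rintro ⟨A, hA, rfl⟩
    rw [genFrame_genCoord hx]
    exact hA
  · intro h
    exact ⟨_, h, genCoord_genFrame hx w⟩

theorem mem_perp_fibCoord (hy : y ∈ (chartAt (Model n) x₀).target) {w : GenModel n} :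
    w ∈ perp (fibCoord E (chartAt (Model n) x₀) y) ↔
      genFrame (chartAt (Model n) x₀) ((chartAt (Model n) x₀).symm y) w ∈
        perp (E.fib ((chartAt (Model n) x₀).symm y)) := by
  have hx := symm_mem_source hy
  constructor
  · intro h A hA
    change pairing A _ = 0
    rw [← pairing_genCoord hx, genCoord_genFrame hx]
    exact h _ ⟨A, hA, rfl⟩
  · rintro h _ ⟨A, hA, rfl⟩
    change pairing _ w = 0
    have h1 : pairing A _ = 0 := h A hA
    rwa [← pairing_genCoord hx, genCoord_genFrame hx] at h1

theorem isGenMetric_fibCoord (hy : y ∈ (chartAt (Model n) x₀).target) :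
    IsGenMetric n (fibCoord E (chartAt (Model n) x₀) y) := by
  have hx := symm_mem_source hy
  have hE := E.isGenMetric ((chartAt (Model n) x₀).symm y)
  obtain ⟨b, hb⟩ := hE.signature
  refine ⟨?_, ⟨b.map ((genEquiv hx).submoduleMap _), fun i j => ?_⟩, ?_⟩
  · exact ((genEquiv hx).submoduleMap _).finrank_eq.symm.trans hE.finrank_eq
  · rw [← hb i j]
    exact pairing_genCoord hx _ _
  · rintro _ ⟨A, hA, rfl⟩ h
    have h1 : tangentCoord (chartAt (Model n) x₀) ((chartAt (Model n) x₀).symm y) A.1 = 0 := h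
    have h2 := tangentFrame_tangentCoord hx A.1
    rw [h1, map_zero] at h2
    rw [hE.inter_dual A hA h2.symm, map_zero]

theorem isOrthProj_projCoord (hy : y ∈ (chartAt (Model n) x₀).target) :
    IsOrthProj (fibCoord E (chartAt (Model n) x₀) y) (projCoord E (chartAt (Model n) x₀) y) := by
  have hx := symm_mem_source hy
  refine ⟨fun w => ⟨_, Submodule.projection_apply_mem _ _, rfl⟩, fun w => ?_,
    (isGenMetric_fibCoord hy).isCompl.disjoint⟩
  rw [mem_perp_fibCoord hy, map_sub]
  change _ - genFrame _ _ (genCoord _ _ (projE E _ (genFrame _ _ w))) ∈ _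
  rw [genFrame_genCoord hx]
  exact Submodule.sub_projection_mem _ _

/-- The chart identification is an isometry, so skewness transfers; invariance of `E` becomes
commutation with the projection, and `K ≠ ± Id` costs nothing because the model space is nontrivial.
-/
theorem reflector_eq_adaptedSet (hn : 2 ≤ n) :
    reflector E (chartAt (Model n) x₀) =
      adaptedSet (chartAt (Model n) x₀).target (projCoord E (chartAt (Model n) x₀)) := by
  have : Nonempty (Fin (2 * n)) := ⟨⟨0, by omega⟩⟩
  have : Nontrivial (Model n) := inferInstance
  ext ⟨y, K⟩
  refine and_congr_right fun hy => ?_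
  change y ∈ (chartAt (Model n) x₀).target at hy
  have hx := symm_mem_source hy
  set e := chartAt (Model n) x₀ with he
  set x := e.symm y with hxdef
  have hKa : ∀ A, (genFrame e x ∘ₗ (K : GenModel n →ₗ[ℝ] GenModel n) ∘ₗ genCoord e x) A =
    genFrame e x (K (genCoord e x A)) := fun A => rfl
  have hskew : (∀ A B, pairing (genFrame e x (K (genCoord e x A))) B +
      pairing A (genFrame e x (K (genCoord e x B))) = 0) ↔ IsSkew K := by
    constructor
    · intro h A B
      have := h (genFrame e x A) (genFrame e x B)
      rwa [genCoord_genFrame hx, genCoord_genFrame hx, pairing_genFrame hx, pairing_genFrame hx]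
        at this
    · intro h A B
      rw [← pairing_genCoord hx, genCoord_genFrame hx, ← pairing_genCoord hx A,
        genCoord_genFrame hx]
      exact h _ _
  have hpres : (∀ A ∈ E.fib x, genFrame e x (K (genCoord e x A)) ∈ E.fib x) ↔
      ∀ w ∈ fibCoord E e y, K w ∈ fibCoord E e y := by
    constructor
    · rintro h _ ⟨A, hA, rfl⟩
      exact (mem_fibCoord hy).2 (h A hA)
    · intro h A hA
      exact (mem_fibCoord hy).1 (h _ ⟨A, hA, rfl⟩)
  constructor
  · rintro ⟨⟨hsq, -, -, hs⟩, hp⟩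
    have hs' := hskew.1 hs
    refine ⟨ContinuousLinearMap.ext fun w => ?_, hs',
      ((isOrthProj_projCoord hy).commute_iff hs').2 (hpres.1 hp)⟩
    have := hsq (genFrame e x w)
    rw [hKa, hKa, genCoord_genFrame hx, genCoord_genFrame hx] at this
    have := congrArg (genCoord e x) this
    rwa [genCoord_genFrame hx, genCoord_genFrame hx] at this
  · rintro ⟨hsq, hs, hc⟩
    have hne : ∀ c : ℝ, c ≠ 0 →
        genFrame e x ∘ₗ (K : GenModel n →ₗ[ℝ] GenModel n) ∘ₗ genCoord e x ≠
          c • LinearMap.id := by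
      intro c hc h
      refine ne_id_of_isSkew hs hc (LinearMap.ext fun w => ?_)
      have := LinearMap.congr_fun h (genFrame e x w)
      rw [hKa, genCoord_genFrame hx] at this
      have := congrArg (genCoord e x) this
      rw [genCoord_genFrame hx] at this
      refine this.trans ?_
      change genCoord e x (c • genFrame e x w) = c • w
      rw [map_smul, genCoord_genFrame hx]
    refine ⟨⟨fun A => ?_, ?_, ?_, hskew.2 hs⟩,
      hpres.2 (((isOrthProj_projCoord hy).commute_iff hs).1 hc)⟩
    · rw [hKa, hKa, genCoord_genFrame hx]
      have h1 : K (K (genCoord e x A)) = genCoord e x A := DFunLike.congr_fun hsq _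
      rw [h1, genFrame_genCoord hx]
    · have := hne 1 one_ne_zero
      rwa [one_smul] at this
    · exact fun h => hne (-1) (by norm_num)
        (h.trans (LinearMap.ext fun A => (neg_one_smul ℝ A).symm))

theorem contDiffOn_projCoord :
    ContDiffOn ℝ ∞ (projCoord E (chartAt (Model n) x₀)) (chartAt (Model n) x₀).target := by
  intro y₀ hy₀
  have hx₀ := symm_mem_source hy₀
  set e := chartAt (Model n) x₀ with he
  obtain ⟨U, hU, hxU, s, hs, hspan⟩ := E.smooth (e.symm y₀)
  set U' := U ∩ e.source with hU'
  have hU'o : IsOpen U' := hU.inter e.open_source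
  have hO : IsOpen (e.target ∩ e.symm ⁻¹' U') := e.isOpen_inter_preimage_symm hU'o
  have hmem : e.target ∩ e.symm ⁻¹' U' ∈ 𝓝 y₀ := hO.mem_nhds ⟨hy₀, hxU, hx₀⟩
  have hσ : ∀ i, ContDiffAt ℝ ∞ (sectionCoord e (s i)) y₀ := fun i =>
    (contDiffOn_sectionCoord hU'o Set.inter_subset_right
      ((hs i).mono Set.inter_subset_left)).contDiffAt hmem
  refine (contDiffAt_orthProj hσ (E := fibCoord E e) ?_ ?_ ?_).contDiffWithinAt
  · filter_upwards [hmem] with y hy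
    rw [fibCoord, hspan _ hy.2.1, Submodule.map_span, ← Set.range_comp]
    rfl
  · filter_upwards [hmem] with y hy
    exact isOrthProj_projCoord hy.1
  · filter_upwards [hmem] with y hy
    rw [(isGenMetric_fibCoord hy.1).finrank_eq]
    simp

end CoordinateProjection

/-! ### Smoothness of a bilinear map given on a basis. -/

section BilinOfBasis

variable {X F : Type*} [NormedAddCommGroup X] [NormedSpace ℝ X]
  [NormedAddCommGroup F] [NormedSpace ℝ F]

instance : NormedAddCommGroup (X →L[ℝ] F →L[ℝ] F) := ContinuousLinearMap.toNormedAddCommGroup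
instance : SeminormedAddCommGroup (X →L[ℝ] F →L[ℝ] F) :=
  ContinuousLinearMap.toSeminormedAddCommGroup
instance : NormedSpace ℝ (X →L[ℝ] F →L[ℝ] F) := ContinuousLinearMap.toNormedSpace

theorem contDiffOn_bilinOfBasis {Y ι : Type*} [FiniteDimensional ℝ F] [Fintype ι]
    [NormedAddCommGroup Y] [NormedSpace ℝ Y] (b : Module.Basis ι ℝ F)
    {c : ι → Y → X →L[ℝ] F} {U : Set Y} (hc : ∀ i, ContDiffOn ℝ ∞ (c i) U) :
    ContDiffOn ℝ ∞ (fun y => bilinOfBasis b fun i => c i y) U := by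
  refine ContDiffOn.sum fun i _ => ?_
  exact (ContinuousLinearMap.compL ℝ X F (F →L[ℝ] F) (ContinuousLinearMap.smulRightL ℝ F F
    (LinearMap.toContinuousLinearMap (b.coord i)))).contDiff.comp_contDiffOn (hc i)

end BilinOfBasis

/-! ### The connection form in a chart. -/

section Connection

variable {n : ℕ} {M : Type*} [TopologicalSpace M] [ChartedSpace (Model n) M]
  [IsManifold 𝓘(ℝ, Model n) ∞ M]

theorem contMDiffOn_tangentFrame (x₀ : M) (v : Model n) :
    ContMDiffOn 𝓘(ℝ, Model n) (𝓘(ℝ, Model n).prod 𝓘(ℝ, Model n)) ∞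
      (fun x => (TotalSpace.mk' (Model n) x (tangentFrame (chartAt (Model n) x₀) x v) :
        TotalSpace (Model n) (TangentSpace 𝓘(ℝ, Model n) : M → Type)))
      (chartAt (Model n) x₀).source := by
  have hb : (chartAt (Model n) x₀).source ⊆
      (trivializationAt (Model n) (TangentSpace 𝓘(ℝ, Model n)) x₀).baseSet := by
    intro x hx
    simpa using hx
  rw [Trivialization.contMDiffOn_section_iff (IB := 𝓘(ℝ, Model n)) (n := ∞)
    (trivializationAt (Model n) (TangentSpace 𝓘(ℝ, Model n)) x₀)
    (chartAt (Model n) x₀).open_source hb]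
  refine (contMDiffOn_const (c := v)).congr fun x hx => ?_
  have h1 := tangentCoord_tangentFrame hx v
  rwa [← continuousLinearMapAt_eq_tangentCoord hx, Trivialization.continuousLinearMapAt_apply,
    Trivialization.linearMapAt_apply, if_pos (hb hx)] at h1

variable {E : GenMetric n M} (D : MetricConnections E) {x₀ : M} {y : Model n}

/-- The section with constant coordinates `w` in a chart. -/
def frameSection (e : OpenPartialHomeomorph M (Model n)) (w : GenModel n) (x : M) :
    GenTangent n M x := genFrame e x w

theorem connForm_basis (x₀ : M) (y v : Model n)
    (i : Fin (Module.finrank ℝ (GenModel n))) :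
    connForm D (chartAt (Model n) x₀) y v (Module.finBasis ℝ (GenModel n) i) =
      genCoord (chartAt (Model n) x₀) ((chartAt (Model n) x₀).symm y)
        (D.D (frameSection (chartAt (Model n) x₀) (Module.finBasis ℝ (GenModel n) i))
          ((chartAt (Model n) x₀).symm y)
          (tangentFrame (chartAt (Model n) x₀) ((chartAt (Model n) x₀).symm y) v)) := by
  rw [connForm, bilinOfBasis_apply]
  rfl

theorem contDiffOn_connForm (x₀ : M) :
    ContDiffOn ℝ ∞ (connForm D (chartAt (Model n) x₀)) (chartAt (Model n) x₀).target := by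
  set e := chartAt (Model n) x₀ with he
  refine contDiffOn_bilinOfBasis _ fun i => ?_
  rw [contDiffOn_clm_apply]
  intro v
  have h1 := (D.smooth e.source e.open_source).contMDiff
    (σ := frameSection e (Module.finBasis ℝ (GenModel n) i)) (contMDiffOn_genFrame x₀ _)
  have h2 := ContMDiffOn.clm_bundle_apply h1 (contMDiffOn_tangentFrame x₀ v)
  have h3 := contDiffOn_sectionCoord (x₀ := x₀) e.open_source subset_rfl h2
  exact h3.mono fun y hy => ⟨hy, e.map_target hy⟩

theorem mvfderiv_of_chart {x₀ x : M} (hx : x ∈ (chartAt (Model n) x₀).source)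
    {g : M → ℝ} {g' : Model n → ℝ}
    (hg : ∀ z ∈ (chartAt (Model n) x₀).source, g z = g' (chartAt (Model n) x₀ z))
    (hd : DifferentiableAt ℝ g' (chartAt (Model n) x₀ x)) :
    MDifferentiableAt 𝓘(ℝ, Model n) 𝓘(ℝ, ℝ) g x ∧
      ∀ v, mvfderiv 𝓘(ℝ, Model n) g x (tangentFrame (chartAt (Model n) x₀) x v) =
        fderiv ℝ g' (chartAt (Model n) x₀ x) v := by
  have h1 : HasMFDerivAt 𝓘(ℝ, Model n) 𝓘(ℝ, Model n) (chartAt (Model n) x₀) x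
      (tangentCoord (chartAt (Model n) x₀) x) :=
    (mdifferentiableAt_atlas (chart_mem_atlas _ x₀) hx).hasMFDerivAt
  have h2 := hd.hasFDerivAt.hasMFDerivAt.comp x h1
  have h3 := h2.congr_of_eventuallyEq (f₁ := g) (by
    filter_upwards [(chartAt (Model n) x₀).open_source.mem_nhds hx] with z hz
    exact hg z hz)
  refine ⟨h3.mdifferentiableAt, fun v => ?_⟩
  rw [mvfderiv, h3.mfderiv]
  exact congrArg _ (tangentCoord_tangentFrame hx v)

theorem D_sum {ι : Type*} (s : Finset ι) {σ : ι → ∀ x : M, GenTangent n M x} {x : M}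
    (hσ : ∀ i ∈ s, SectionDiffAt (σ i) x) :
    SectionDiffAt (∑ i ∈ s, σ i) x ∧ D.D (∑ i ∈ s, σ i) x = ∑ i ∈ s, D.D (σ i) x := by
  classical
  induction s using Finset.induction_on with
  | empty =>
    simp only [Finset.sum_empty]
    refine ⟨mdifferentiableAt_zeroSection _ _, ?_⟩
    rw [D.D.zero]; rfl
  | insert i s hi ih =>
    obtain ⟨h1, h2⟩ := ih fun j hj => hσ j (Finset.mem_insert_of_mem hj)
    have h3 := hσ i (Finset.mem_insert_self i s)
    rw [Finset.sum_insert hi, Finset.sum_insert hi]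
    exact ⟨mdifferentiableAt_add_section h3 h1, by
      rw [D.D.isCovariantDerivativeOnUniv.add h3 h1, h2]⟩

set_option maxHeartbeats 1000000 in
-- The formula `D = d + Γ`. Since `connForm` is prescribed only on a basis, `σ` is expanded in the
-- coordinate frame near the point and the Leibniz rule is applied to each term, locality of `D`
-- allowing the replacement.
theorem genCoord_D (hy : y ∈ (chartAt (Model n) x₀).target) {σ : ∀ x : M, GenTangent n M x}
    (hσ : SectionDiffAt σ ((chartAt (Model n) x₀).symm y)) (v : Model n) :
    genCoord (chartAt (Model n) x₀) ((chartAt (Model n) x₀).symm y)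
        (D.D σ ((chartAt (Model n) x₀).symm y)
          (tangentFrame (chartAt (Model n) x₀) ((chartAt (Model n) x₀).symm y) v)) =
      fderiv ℝ (sectionCoord (chartAt (Model n) x₀) σ) y v +
        connForm D (chartAt (Model n) x₀) y v (sectionCoord (chartAt (Model n) x₀) σ y) := by
  have hx := symm_mem_source hy
  have hσ' := (sectionDiffAt_iff hx).1 hσ
  have hconn := connForm_basis D x₀ y v
  set e := chartAt (Model n) x₀ with he
  set x := e.symm y with hxdef
  have hex : e x = y := e.right_inv hy
  rw [hex] at hσ'
  set b := Module.finBasis ℝ (GenModel n) with hb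
  set c : Fin (Module.finrank ℝ (GenModel n)) → M → ℝ := fun i z =>
    b.repr (genCoord e z (σ z)) i with hc
  have hcx : ∀ i, MDifferentiableAt 𝓘(ℝ, Model n) 𝓘(ℝ, ℝ) (c i) x ∧
      ∀ w, mvfderiv 𝓘(ℝ, Model n) (c i) x (tangentFrame e x w) =
        b.repr (fderiv ℝ (sectionCoord e σ) y w) i := by
    intro i
    set L : GenModel n →L[ℝ] ℝ := LinearMap.toContinuousLinearMap (b.coord i) with hL
    have hd : HasFDerivAt (fun z => L (sectionCoord e σ z))
        (L.comp (fderiv ℝ (sectionCoord e σ) y)) y :=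
      L.hasFDerivAt.comp y hσ'.hasFDerivAt
    have h1 := mvfderiv_of_chart (g := c i) (g' := fun z => L (sectionCoord e σ z)) hx
      (fun z hz => by
        change b.repr (genCoord e z (σ z)) i =
          b.repr (genCoord e (e.symm (e z)) (σ (e.symm (e z)))) i
        rw [e.left_inv hz]) (by rw [← he, hex]; exact hd.differentiableAt)
    refine ⟨h1.1, fun w => (h1.2 w).trans ?_⟩
    rw [← he, hex, hd.fderiv]
    rfl
  have hs : ∀ i, SectionDiffAt (frameSection (M := M) e (b i)) x := fun i =>
    ((contMDiffOn_genFrame x₀ (b i)).contMDiffAt (e.open_source.mem_nhds hx)).mdifferentiableAt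
      (by simp)
  have hcs : ∀ i ∈ Finset.univ, SectionDiffAt (c i • frameSection (M := M) e (b i)) x :=
    fun i _ => MDifferentiableAt.smul_section (hcx i).1 (hs i)
  obtain ⟨hd, hD⟩ := D_sum D Finset.univ hcs
  have heq : D.D σ x = D.D (∑ i, c i • frameSection (M := M) e (b i)) x := by
    refine D.D.isCovariantDerivativeOnUniv.congr_of_eventuallyEq hσ hd Filter.univ_mem ?_
    filter_upwards [e.open_source.mem_nhds hx] with z hz
    rw [Finset.sum_apply]
    change σ z = ∑ i, b.repr (genCoord e z (σ z)) i • genFrame e z (b i)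
    simp only [← map_smul]
    rw [← map_sum, b.sum_repr, genFrame_genCoord hz]
  rw [heq, hD, sum_apply, map_sum]
  have hterm : ∀ i, genCoord e x (D.D (c i • frameSection (M := M) e (b i)) x
      (tangentFrame e x v)) = b.repr (sectionCoord e σ y) i • connForm D e y v (b i) +
        b.repr (fderiv ℝ (sectionCoord e σ) y v) i • b i := by
    intro i
    rw [D.D.isCovariantDerivativeOnUniv.leibniz (hs i) (hcx i).1]
    change genCoord e x (c i x • D.D (frameSection (M := M) e (b i)) x (tangentFrame e x v) +
      mvfderiv 𝓘(ℝ, Model n) (c i) x (tangentFrame e x v) • genFrame e x (b i)) = _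
    rw [map_add, map_smul, map_smul, (hcx i).2, genCoord_genFrame hx, hconn]
    rfl
  rw [Finset.sum_congr rfl fun i _ => hterm i, Finset.sum_add_distrib, b.sum_repr, add_comm]
  congr 1
  simp only [← map_smul]
  rw [← map_sum, b.sum_repr]

end Connection

/-! ### Consequences of preserving the splitting and the metric. -/

section Parallel

variable {n : ℕ} {M : Type*} [TopologicalSpace M] [ChartedSpace (Model n) M]
  [IsManifold 𝓘(ℝ, Model n) ∞ M] {E : GenMetric n M} (D : MetricConnections E)
  {x₀ : M} {y : Model n}

/-- The component in `E'` of the section with constant coordinates `w` in a chart. -/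
def fibSection (E : GenMetric n M) (e : OpenPartialHomeomorph M (Model n)) (w : GenModel n)
    (x : M) : GenTangent n M x := projE E x (genFrame e x w)

/-- The component in `E''` of the section with constant coordinates `w` in a chart. -/
def perpSection (E : GenMetric n M) (e : OpenPartialHomeomorph M (Model n)) (w : GenModel n)
    (x : M) : GenTangent n M x := genFrame e x w - projE E x (genFrame e x w)

theorem fibSection_mem (e : OpenPartialHomeomorph M (Model n)) (w : GenModel n) (x : M) :
    fibSection E e w x ∈ E.fib x :=
  Submodule.projection_apply_mem _ _

theorem perpSection_mem (e : OpenPartialHomeomorph M (Model n)) (w : GenModel n) (x : M) :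
    perpSection E e w x ∈ perp (E.fib x) :=
  have : FiniteDimensional ℝ (GenTangent n M x) :=
    inferInstanceAs (FiniteDimensional ℝ (GenModel n))
  Submodule.sub_projection_mem (E.isGenMetric x).isCompl _

theorem sectionCoord_perpSection (w : GenModel n) {z : Model n}
    (hz : z ∈ (chartAt (Model n) x₀).target) :
    sectionCoord (chartAt (Model n) x₀) (perpSection E (chartAt (Model n) x₀) w) z =
      w - projCoord E (chartAt (Model n) x₀) z w := by
  change genCoord _ _ (genFrame _ _ w - _) = _
  rw [map_sub, genCoord_genFrame (symm_mem_source hz)]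
  rfl

theorem hasFDerivAt_projCoord_apply (hy : y ∈ (chartAt (Model n) x₀).target) (w : GenModel n) :
    HasFDerivAt (fun z => projCoord E (chartAt (Model n) x₀) z w)
      ((fderiv ℝ (projCoord E (chartAt (Model n) x₀)) y).flip w) y := by
  have h1 : DifferentiableAt ℝ (projCoord E (chartAt (Model n) x₀)) y :=
    (contDiffOn_projCoord.contDiffAt
      ((chartAt (Model n) x₀).open_target.mem_nhds hy)).differentiableAt (by simp)
  exact (ContinuousLinearMap.apply ℝ (GenModel n) w).hasFDerivAt.comp y h1.hasFDerivAt

theorem hasFDerivAt_fibSection (hy : y ∈ (chartAt (Model n) x₀).target) (w : GenModel n) :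
    HasFDerivAt (sectionCoord (chartAt (Model n) x₀) (fibSection E (chartAt (Model n) x₀) w))
      ((fderiv ℝ (projCoord E (chartAt (Model n) x₀)) y).flip w) y :=
  hasFDerivAt_projCoord_apply hy w

theorem hasFDerivAt_perpSection (hy : y ∈ (chartAt (Model n) x₀).target) (w : GenModel n) :
    HasFDerivAt (sectionCoord (chartAt (Model n) x₀) (perpSection E (chartAt (Model n) x₀) w))
      (-(fderiv ℝ (projCoord E (chartAt (Model n) x₀)) y).flip w) y := by
  refine ((hasFDerivAt_projCoord_apply hy w).const_sub w).congr_of_eventuallyEq ?_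
  filter_upwards [(chartAt (Model n) x₀).open_target.mem_nhds hy] with z hz
  exact sectionCoord_perpSection w hz

theorem sectionDiffAt_of_hasFDerivAt (hy : y ∈ (chartAt (Model n) x₀).target)
    {σ : ∀ x : M, GenTangent n M x} {σ' : Model n →L[ℝ] GenModel n}
    (h : HasFDerivAt (sectionCoord (chartAt (Model n) x₀) σ) σ' y) :
    SectionDiffAt σ ((chartAt (Model n) x₀).symm y) := by
  rw [sectionDiffAt_iff (symm_mem_source hy), (chartAt (Model n) x₀).right_inv hy]
  exact h.differentiableAt

theorem fibSection_parallel (hy : y ∈ (chartAt (Model n) x₀).target) (v : Model n)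
    (w : GenModel n) :
    fderiv ℝ (projCoord E (chartAt (Model n) x₀)) y v w +
        connForm D (chartAt (Model n) x₀) y v (projCoord E (chartAt (Model n) x₀) y w) ∈
      fibCoord E (chartAt (Model n) x₀) y := by
  have h1 := hasFDerivAt_fibSection (E := E) hy w
  have h2 := genCoord_D D hy (sectionDiffAt_of_hasFDerivAt hy h1) v
  rw [h1.fderiv] at h2
  have h3 := D.preserves _ _ (sectionDiffAt_of_hasFDerivAt hy h1) (fibSection_mem _ w)
    (tangentFrame (chartAt (Model n) x₀) ((chartAt (Model n) x₀).symm y) v)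
  exact ⟨_, h3, h2⟩

theorem perpSection_parallel (hy : y ∈ (chartAt (Model n) x₀).target) (v : Model n)
    (w : GenModel n) :
    -(fderiv ℝ (projCoord E (chartAt (Model n) x₀)) y v w) +
        connForm D (chartAt (Model n) x₀) y v (w - projCoord E (chartAt (Model n) x₀) y w) ∈
      perp (fibCoord E (chartAt (Model n) x₀) y) := by
  have h1 := hasFDerivAt_perpSection (E := E) hy w
  have h2 := genCoord_D D hy (sectionDiffAt_of_hasFDerivAt hy h1) v
  rw [h1.fderiv, sectionCoord_perpSection w hy] at h2
  have h3 := D.preserves_perp _ _ (sectionDiffAt_of_hasFDerivAt hy h1) (perpSection_mem _ w)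
    (tangentFrame (chartAt (Model n) x₀) ((chartAt (Model n) x₀).symm y) v)
  rw [mem_perp_fibCoord hy]
  have h4 := congrArg (genFrame (chartAt (Model n) x₀) ((chartAt (Model n) x₀).symm y)) h2
  rw [genFrame_genCoord (symm_mem_source hy)] at h4
  rw [h4] at h3
  exact h3

/-- The projection onto `E'` is parallel. For constant `w`, the sections `P w` and `(1 - P) w` lie
in `E'` and `E''`, hence so do `P' w + Γ P w` and `-P' w + Γ (1 - P) w`; applying `P` to both gives
the identity. -/
theorem fderiv_projCoord (hy : y ∈ (chartAt (Model n) x₀).target) (v : Model n) :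
    fderiv ℝ (projCoord E (chartAt (Model n) x₀)) y v =
      projCoord E (chartAt (Model n) x₀) y * connForm D (chartAt (Model n) x₀) y v -
        connForm D (chartAt (Model n) x₀) y v * projCoord E (chartAt (Model n) x₀) y := by
  have hp := isOrthProj_projCoord (E := E) hy
  have h1 := fun w => hp.apply_of_mem (fibSection_parallel D hy v w)
  have h2 := fun w => hp.apply_of_mem_perp (perpSection_parallel D hy v w)
  generalize projCoord E (chartAt (Model n) x₀) y = p at *
  generalize connForm D (chartAt (Model n) x₀) y v = Γ at *
  generalize fderiv ℝ (projCoord E (chartAt (Model n) x₀)) y v = p' at *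
  refine ContinuousLinearMap.ext fun w => ?_
  have h3 := h1 w
  have h4 := h2 w
  change p' w = p (Γ w) - Γ (p w)
  rw [map_add] at h3
  rw [map_add, map_neg, map_sub, map_sub] at h4
  have h5 : p (p' w) = p (Γ w) - p (Γ (p w)) := by
    rw [neg_add_eq_zero] at h4
    exact h4
  rw [h5, sub_add_cancel] at h3
  exact eq_sub_of_add_eq h3.symm

/-- The neutral metric has constant coefficients in the chart, so the derivative terms of `D = d +
Γ` cancel against the derivative of the pairing and only `Γ` remains. -/
theorem pairing_metric (hy : y ∈ (chartAt (Model n) x₀).target)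
    {σ τ : ∀ x : M, GenTangent n M x} {σ' τ' : Model n →L[ℝ] GenModel n}
    (hσ : HasFDerivAt (sectionCoord (chartAt (Model n) x₀) σ) σ' y)
    (hτ : HasFDerivAt (sectionCoord (chartAt (Model n) x₀) τ) τ' y)
    (h : (∀ z, σ z ∈ E.fib z) ∧ (∀ z, τ z ∈ E.fib z) ∨
      (∀ z, σ z ∈ perp (E.fib z)) ∧ (∀ z, τ z ∈ perp (E.fib z))) (v : Model n) :
    pairing (connForm D (chartAt (Model n) x₀) y v (sectionCoord (chartAt (Model n) x₀) σ y))
        (sectionCoord (chartAt (Model n) x₀) τ y) +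
      pairing (sectionCoord (chartAt (Model n) x₀) σ y)
        (connForm D (chartAt (Model n) x₀) y v (sectionCoord (chartAt (Model n) x₀) τ y)) = 0 := by
  have hx := symm_mem_source hy
  have hσd := sectionDiffAt_of_hasFDerivAt hy hσ
  have hτd := sectionDiffAt_of_hasFDerivAt hy hτ
  have h1 := D.metric σ τ _ hσd hτd h
    (tangentFrame (chartAt (Model n) x₀) ((chartAt (Model n) x₀).symm y) v)
  have hd : HasFDerivAt (fun z => pairingL (sectionCoord (chartAt (Model n) x₀) σ z)
      (sectionCoord (chartAt (Model n) x₀) τ z)) _ y :=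
    (pairingL.hasFDerivAt.comp y hσ).clm_apply hτ
  have h2 := (mvfderiv_of_chart hx (g := fun z => pairing (σ z) (τ z))
    (g' := fun z => pairingL (sectionCoord (chartAt (Model n) x₀) σ z)
      (sectionCoord (chartAt (Model n) x₀) τ z)) (fun z hz => by
        change _ = pairing (genCoord _ ((chartAt (Model n) x₀).symm _) _)
          (genCoord _ ((chartAt (Model n) x₀).symm _) _)
        rw [(chartAt (Model n) x₀).left_inv hz, pairing_genCoord hz])
    (by rw [(chartAt (Model n) x₀).right_inv hy]; exact hd.differentiableAt)).2 v
  rw [(chartAt (Model n) x₀).right_inv hy, hd.fderiv] at h2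
  rw [h2, ← pairing_genCoord hx, ← pairing_genCoord hx, genCoord_D D hy hσd, genCoord_D D hy hτd,
    hσ.fderiv, hτ.fderiv, map_add, map_add, LinearMap.add_apply] at h1
  have h3 : pairing (sectionCoord (chartAt (Model n) x₀) σ y) (τ' v) +
      pairing (σ' v) (sectionCoord (chartAt (Model n) x₀) τ y) =
      pairing (σ' v) (sectionCoord (chartAt (Model n) x₀) τ y) +
        pairing (connForm D (chartAt (Model n) x₀) y v
          (sectionCoord (chartAt (Model n) x₀) σ y)) (sectionCoord (chartAt (Model n) x₀) τ y) +
      (pairing (sectionCoord (chartAt (Model n) x₀) σ y) (τ' v) +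
        pairing (sectionCoord (chartAt (Model n) x₀) σ y) (connForm D (chartAt (Model n) x₀) y v
          (sectionCoord (chartAt (Model n) x₀) τ y))) := h1
  linarith

/-- Metricity yields skewness on each diagonal block only. For the mixed blocks, test the symmetry
of `p' = [p, Γ]` on a vector of the image of `p` and one of its kernel. -/
theorem isSkew_of_blocks {X : Type*} [NormedAddCommGroup X] [NormedSpace ℝ X] {p Γ p' : EndGen X}
    (hpp : p * p = p) (hp : IsSymm p) (hp' : IsSymm p') (hpar : p' = p * Γ - Γ * p)
    (h1 : ∀ A B, pairing (Γ (p A)) (p B) + pairing (p A) (Γ (p B)) = 0)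
    (h2 : ∀ A B, pairing (Γ (A - p A)) (B - p B) + pairing (A - p A) (Γ (B - p B)) = 0) :
    IsSkew Γ := by
  have hppa : ∀ A, p (p A) = p A := fun A => DFunLike.congr_fun hpp A
  have hpar' : ∀ A, p' A = p (Γ A) - Γ (p A) := fun A => DFunLike.congr_fun hpar A
  have h3 : ∀ A B, pairing (Γ (p A)) (B - p B) + pairing (p A) (Γ (B - p B)) = 0 := by
    intro A B
    have e := hp' (p A) (B - p B)
    rw [hpar', hpar', hppa, map_sub p B, hppa, sub_self, map_zero, sub_zero] at e
    rw [← hp (p A), hppa] at e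
    have f1 := hp (Γ (p A)) B
    have f2 := hp (Γ (p A)) (p B)
    rw [hppa] at f2
    simp only [map_sub, LinearMap.sub_apply] at e ⊢
    linarith
  have h4 : ∀ A B, pairing (Γ (A - p A)) (p B) + pairing (A - p A) (Γ (p B)) = 0 := by
    intro A B
    have := h3 B A
    rw [pairing_comm (Γ (A - p A)), pairing_comm (A - p A)]
    linarith
  intro A B
  have e1 := h1 A B
  have e2 := h2 A B
  have e3 := h3 A B
  have e4 := h4 A B
  simp only [map_sub, LinearMap.sub_apply] at e1 e2 e3 e4
  linarith

theorem isSymm_of_hasFDerivAt {X : Type*} [NormedAddCommGroup X] [NormedSpace ℝ X]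
    {P : X → EndGen X} {P' : X →L[ℝ] EndGen X} {y : X} (h : HasFDerivAt P P' y)
    (hP : ∀ᶠ z in 𝓝 y, IsSymm (P z)) (v : X) : IsSymm (P' v) := by
  intro A B
  have hA : HasFDerivAt (fun z => P z A) (P'.flip A) y :=
    (ContinuousLinearMap.apply ℝ (GenVec X) A).hasFDerivAt.comp y h
  have hB : HasFDerivAt (fun z => P z B) (P'.flip B) y :=
    (ContinuousLinearMap.apply ℝ (GenVec X) B).hasFDerivAt.comp y h
  have h1 : HasFDerivAt (fun z => pairingL (P z A) B) ((pairingL.flip B).comp (P'.flip A)) y :=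
    (pairingL.flip B).hasFDerivAt.comp y hA
  have h2 : HasFDerivAt (fun z => pairingL A (P z B)) ((pairingL A).comp (P'.flip B)) y :=
    (pairingL A).hasFDerivAt.comp y hB
  have h3 := h1.unique (h2.congr_of_eventuallyEq (hP.mono fun z hz => hz A B))
  exact DFunLike.congr_fun h3 v

theorem isSkew_connForm (hy : y ∈ (chartAt (Model n) x₀).target) (v : Model n) :
    IsSkew (connForm D (chartAt (Model n) x₀) y v) := by
  have hp := isOrthProj_projCoord (E := E) hy
  have hnhds := (chartAt (Model n) x₀).open_target.mem_nhds hy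
  have hd : DifferentiableAt ℝ (projCoord E (chartAt (Model n) x₀)) y :=
    (contDiffOn_projCoord.contDiffAt hnhds).differentiableAt (by simp)
  refine isSkew_of_blocks hp.mul_self hp.isSymm (isSymm_of_hasFDerivAt hd.hasFDerivAt ?_ v)
    (fderiv_projCoord D hy v) (fun A B => ?_) fun A B => ?_
  · filter_upwards [hnhds] with z hz
    exact (isOrthProj_projCoord hz).isSymm
  · exact pairing_metric D hy (hasFDerivAt_fibSection hy A) (hasFDerivAt_fibSection hy B)
      (Or.inl ⟨fibSection_mem _ A, fibSection_mem _ B⟩) v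
  · have := pairing_metric D hy (hasFDerivAt_perpSection hy A) (hasFDerivAt_perpSection hy B)
      (Or.inr ⟨perpSection_mem _ A, perpSection_mem _ B⟩) v
    rwa [sectionCoord_perpSection A hy, sectionCoord_perpSection B hy] at this

theorem eq_zero_of_neg_eq_self {X : Type*} [AddCommGroup X] [Module ℝ X] {x : X} (h : -x = x) :
    x = 0 := by
  have h1 : (2 : ℝ) • x = 0 := by
    rw [two_smul]
    nth_rewrite 1 [← h]
    exact neg_add_cancel x
  exact (smul_eq_zero.1 h1).resolve_left two_ne_zero

/-- On the summand with sign `-1`, the Nijenhuis identity reads `-x = x` for `x` the vector part of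
`K V A`, against the choice of `K`, `V` and `A`. -/
theorem not_integrable (hn : 2 ≤ n) [Nonempty M] {ε : Index} (hε : ε.sgn₁ = -1 ∨ ε.sgn₂ = -1) :
    ¬ Integrable D ε := by
  intro hint
  obtain ⟨x₀⟩ := ‹Nonempty M›
  have hy : chartAt (Model n) x₀ x₀ ∈ (chartAt (Model n) x₀).target :=
    (chartAt (Model n) x₀).map_source (mem_chart_source _ x₀)
  have h := hint _ (chart_mem_atlas (Model n) x₀)
  rw [reflector_eq_adaptedSet hn] at h
  have hp := isOrthProj_projCoord (E := E) hy
  obtain ⟨K, V, hKK, hKs, hKp, hVs, hVa, hVp, ⟨A, hA, hA'⟩, ⟨B, hB, hB'⟩⟩ :=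
    (isGenMetric_fibCoord (E := E) hy).exists_vertical hn (fun A hA => hp.apply_of_mem hA)
      (fun A hA => hp.apply_of_mem_perp hA)
  have key := fibreStructure_eq_of_isIntegrable (chartAt (Model n) x₀).open_target
    contDiffOn_projCoord (contDiffOn_connForm D x₀)
    (fun z hz => (isOrthProj_projCoord hz).mul_self) (fun z hz => (isOrthProj_projCoord hz).isSymm)
    (fun z hz => fderiv_projCoord D hz) (fun z hz => isSkew_connForm D hz) h
    (a := (chartAt (Model n) x₀ x₀, K)) ⟨hy, hKK, hKs, hKp⟩ hVs hVa hVp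
  rcases hε with hε | hε
  · have h1 := key A
    rw [fibreStructure_apply, hp.apply_of_mem hA, hε, sub_self, map_zero, map_zero, smul_zero,
      add_zero, neg_one_smul, Prod.fst_neg] at h1
    exact hA' (eq_zero_of_neg_eq_self h1)
  · have h1 := key B
    rw [fibreStructure_apply, hp.apply_of_mem_perp hB, hε, sub_zero, map_zero, map_zero, smul_zero,
      zero_add, neg_one_smul, Prod.fst_neg] at h1
    exact hB' (eq_zero_of_neg_eq_self h1)

end Parallel

end GenReflector

end

theorem mainTheorem3 {n : ℕ} (hn : 2 ≤ n) {M : Type*} [TopologicalSpace M]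
    [ChartedSpace (GenReflector.Model n) M]
    [IsManifold 𝓘(ℝ, GenReflector.Model n) ∞ M] [Nonempty M]
    (E : GenReflector.GenMetric n M) (D : GenReflector.MetricConnections E) :
    ¬ GenReflector.Integrable D .two ∧ ¬ GenReflector.Integrable D .three ∧
      ¬ GenReflector.Integrable D .four :=
  ⟨GenReflector.not_integrable D hn (Or.inr rfl), GenReflector.not_integrable D hn (Or.inl rfl),
    GenReflector.not_integrable D hn (Or.inl rfl)⟩
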